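/- For a nonempty set $A \subseteq \mathbb{Z}_2^n$ let $A+A=\{a+b : a,b\in A\}$ and let $\langle A\rangle$ be the affine span of $A$, i.e. the smallest coset of a subgroup of $\mathbb{Z}_2^n$ that contains $A$. For real $K\ge 1$ let $$F(K)=\sup\left\{\frac{|\langle A\rangle|}{|A|} \;:\; n\in\mathbb{N},\ \varnothing\ne A\subseteq\mathbb{Z}_2^n,\ \frac{|A+A|}{|A|}\le K\right\}.$$ For every real $K\ge 1$ there is a unique integer $t\ge 1$ with $$\frac{\binom{t}{2}+t+1}{t+1}\le K<\frac{\binom{t+1}{2}+(t+1)+1}{(t+1)+1},$$ the supremum $F(K)$ is finite, and for this $t$ $$F(K)=\begin{cases}\dfrac{2^t}{\binom{t}{2}+t+1}\cdot K & \text{if } K<\dfrac{t^2+t+1}{2t},\\[2ex] \dfrac{2^{t+1}}{t^2+t+1}\cdot K & \text{if } K\ge\dfrac{t^2+t+1}{2t}.\end{cases}$$ That is, every nonempty $A\subseteq\mathbb{Z}_2^n$ with $|A+A|\le K|A|$ satisfies $|\langle A\rangle|\le F(K)|A|$ with this value of $F(K)$, and no smaller value has this property for all $n$ and $A$. Moreover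 $F(K)=\Theta\left(2^{2K}/K\right)$ as $K\to\infty$. -/

import Mathlib

open scoped Pointwise

noncomputable section

/-- The doubling constant `|A + A| / |A|` of a finite subset of `ℤ₂ⁿ`. -/
def doublingConstant {n : ℕ} (A : Finset (Fin n → ZMod 2)) : ℝ :=
  ((A + A).card : ℝ) / (A.card : ℝ)

/-- The spanning constant `|⟨A⟩| / |A|` of a finite subset of `ℤ₂ⁿ`. The affine span over `ZMod 2`
of a nonempty set is the smallest coset of a subgroup of `ℤ₂ⁿ` that contains it, because the
`ZMod 2`-linear subspaces of `ℤ₂ⁿ` are exactly its subgroups. -/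
def spanningConstant {n : ℕ} (A : Finset (Fin n → ZMod 2)) : ℝ :=
  (Nat.card (affineSpan (ZMod 2) (A : Set (Fin n → ZMod 2))) : ℝ) / (A.card : ℝ)

/-- All the spanning constants of nonempty sets `A ⊆ ℤ₂ⁿ`, over all `n`, whose doubling constant
is at most `K`. -/
def spanningConstants (K : ℝ) : Set ℝ :=
  {x | ∃ (n : ℕ) (A : Finset (Fin n → ZMod 2)),
    A.Nonempty ∧ doublingConstant A ≤ K ∧ x = spanningConstant A}

/-- `F(K)`, the least upper bound of the spanning constants of the nonempty sets of doubling
constant at most `K`. -/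
def freimanF (K : ℝ) : ℝ := sSup (spanningConstants K)

/-- The breakpoint `(C(t,2) + t + 1) / (t + 1)`. -/
def breakpoint (t : ℕ) : ℝ := ((t.choose 2 : ℝ) + t + 1) / ((t : ℝ) + 1)

/-- The breakpoint `(t² + t + 1) / (2t)`. -/
def midBreakpoint (t : ℕ) : ℝ := ((t : ℝ) ^ 2 + t + 1) / (2 * t)

end

/-! ### Compressions along a direction, and simultaneous stabilisation of two sets. -/

section Compression

variable {V : Type*} [AddCommGroup V] [Module (ZMod 2) V]

/-! Upper bound. Inside the direction of its affine span, `A` becomes an affinely generating subset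
of a finite group `V`, and `|V|` is to be bounded. A compression pushes points into a hyperplane
along a fixed direction; it keeps `|A|` and does not enlarge `|A + A|`
(`compress_add_compress_subset`). Among the generating sets of the same size with no larger sumset,
take one containing a coset of the largest possible subgroup, translated to a subgroup `H`. Further
compressions and the maximality of `H` turn it into a star (`exists_star`): `H` together with
nonempty arms in cosets `w i + H`, with `w i` independent modulo `H`, `|V| = |H| 2 ^ M`, and any two
arms having at most `|H|` points together.

Divide by `|H|`. If `y i` are the arm sizes and `h i k` the sizes of the pairwise arm sums, then
`|A| ≤ |H| α` with `α = 1 + ∑ y i`, and `|A + A| ≥ |H| D` with `D = 1 + M + ∑_{i<k} h i k`. It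
suffices to find a density `δ` and a breakpoint `b`, taken together from the list of `MeetsBound`,
with `2 ^ M δ ≤ D` and `b α ≤ D`. The first gives `|V| δ ≤ K |A|`. The second gives `b ≤ K`, so `δ`
occurs no later in the list than the density belonging to `K`; as densities decrease along the list,
`|V| / |A|` is at most `K` over the latter (`spanningConstant_le`).

Such a pair comes from the averaging bound `h i k ≥ (y i + y k) / 2`, except when `2 ^ M ballDensity
(M + 2) ≤ D < 2 ^ M ballDensity (M + 1)`. In that window some two arms total at most `1/2`, which
caps `α`. If `D ≥ 2 ^ M midDensity (M + 1)`, the cap is exactly what the middle breakpoint of `M +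
1` needs. Otherwise the loss of the `h i k` against `1/2` exceeds `1/4`, and `half_sum_loss_le`
charges it to the deficiencies `1/2 - y i`, using the sumset bounds `two_pow_le_card_add` and
`natCard_add_two_mul_card_le`.

Lower bound. The Hamming ball of radius `1`, and its double with two points removed, have the
extremal densities. Multiplying by a large cube and deleting points while still generating raises
the doubling to any prescribed `K`, and the spanning constant to nearly the claimed value
(`exists_mem_spanningConstants_gt`). -/

lemma zmod_two_cases (a : ZMod 2) : a = 0 ∨ a = 1 := by
  revert a; decide

lemma add_add_cancel_two (x g : V) : x + g + g = x := by
  rw [add_assoc, ZModModule.add_self, add_zero]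

variable [DecidableEq V]

/-- Compression of `A` in the direction `g`: an element outside the kernel of `f` is moved by `g`
unless its destination is already occupied. -/
def compress (f : V →ₗ[ZMod 2] ZMod 2) (g : V) (A : Finset V) : Finset V :=
  A.image (fun x => if f x = 1 ∧ x + g ∉ A then x + g else x)

lemma mem_compress {f : V →ₗ[ZMod 2] ZMod 2} {g : V} (hg : f g = 1) {A : Finset V} {x : V} :
    x ∈ compress f g A ↔
      (f x = 0 ∧ (x ∈ A ∨ x + g ∈ A)) ∨ (f x = 1 ∧ x ∈ A ∧ x + g ∈ A) := by
  have h11 : (1 : ZMod 2) + 1 = 0 := by decide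
  have h01 : (0 : ZMod 2) ≠ 1 := by decide
  unfold compress
  rw [Finset.mem_image]
  constructor
  · rintro ⟨y, hy, rfl⟩
    split_ifs with h
    · left
      refine ⟨by rw [map_add, h.1, hg, h11], Or.inr ?_⟩
      rwa [add_add_cancel_two]
    · rcases zmod_two_cases (f y) with h0 | h1
      · exact Or.inl ⟨h0, Or.inl hy⟩
      · right
        refine ⟨h1, hy, ?_⟩
        by_contra h2
        exact h ⟨h1, h2⟩
  · rintro (⟨h0, hx | hx⟩ | ⟨h1, hx, hxg⟩)
    · exact ⟨x, hx, by rw [if_neg]; rintro ⟨h, -⟩; exact h01 (h0.symm.trans h)⟩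
    · by_cases hxA : x ∈ A
      · exact ⟨x, hxA, by rw [if_neg]; rintro ⟨h, -⟩; exact h01 (h0.symm.trans h)⟩
      · refine ⟨x + g, hx, ?_⟩
        rw [if_pos, add_add_cancel_two]
        rw [add_add_cancel_two, map_add, h0, hg]
        exact ⟨by decide, hxA⟩
    · exact ⟨x, hx, by rw [if_neg]; rintro ⟨-, h⟩; exact h hxg⟩

lemma card_compress (f : V →ₗ[ZMod 2] ZMod 2) (g : V) (A : Finset V) :
    (compress f g A).card = A.card := by
  unfold compress
  apply Finset.card_image_of_injOn
  intro x hx y hy hxy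
  simp only at hxy
  split_ifs at hxy with h1 h2 h2
  · exact add_right_cancel hxy
  · exact absurd (hxy ▸ hy) h1.2
  · exact absurd (hxy ▸ hx) h2.2
  · exact hxy

/-- On each pair `{x, x + g}` compression keeps the kernel point if the pair meets the set, and the
outer point only if the pair is full. An outer sum uses an outer summand, hence a full pair, and a
full pair plus a pair meeting `B` (or `A`) fills a pair of the sumset. -/
lemma compress_add_compress_subset {f : V →ₗ[ZMod 2] ZMod 2} {g : V} (hg : f g = 1)
    (A B : Finset V) : compress f g A + compress f g B ⊆ compress f g (A + B) := by
  have h11 : (1 : ZMod 2) + 1 = 0 := by decide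
  intro z hz
  obtain ⟨x, hx, y, hy, rfl⟩ := Finset.mem_add.1 hz
  rw [mem_compress hg] at hx hy ⊢
  have e1 : x + y + g = x + g + y := by abel
  have e2 : x + y + g = x + (y + g) := by abel
  have e3 : x + y = (x + g) + (y + g) := by
    rw [add_add_add_comm, ZModModule.add_self, add_zero]
  rw [map_add]
  rcases hx with ⟨hfx, hx⟩ | ⟨hfx, hx, hxg⟩ <;> rcases hy with ⟨hfy, hy⟩ | ⟨hfy, hy, hyg⟩ <;>
    rw [hfx, hfy]
  · refine Or.inl ⟨add_zero _, ?_⟩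
    rcases hx with hx | hx <;> rcases hy with hy | hy
    · exact Or.inl (Finset.add_mem_add hx hy)
    · exact Or.inr (e2 ▸ Finset.add_mem_add hx hy)
    · exact Or.inr (e1 ▸ Finset.add_mem_add hx hy)
    · exact Or.inl (e3 ▸ Finset.add_mem_add hx hy)
  · refine Or.inr ⟨zero_add _, ?_⟩
    rcases hx with hx | hx
    · exact ⟨Finset.add_mem_add hx hy, e2 ▸ Finset.add_mem_add hx hyg⟩
    · exact ⟨e3 ▸ Finset.add_mem_add hx hyg, e1 ▸ Finset.add_mem_add hx hy⟩
  · refine Or.inr ⟨add_zero _, ?_⟩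
    rcases hy with hy | hy
    · exact ⟨Finset.add_mem_add hx hy, e1 ▸ Finset.add_mem_add hxg hy⟩
    · exact ⟨e3 ▸ Finset.add_mem_add hxg hy, e2 ▸ Finset.add_mem_add hx hy⟩
  · exact Or.inl ⟨h11, Or.inl (Finset.add_mem_add hx hy)⟩

lemma card_compress_add_le {f : V →ₗ[ZMod 2] ZMod 2} {g : V} (hg : f g = 1)
    (A B : Finset V) : (compress f g A + compress f g B).card ≤ (A + B).card :=
  (Finset.card_le_card (compress_add_compress_subset hg A B)).trans (card_compress f g _).le

lemma filter_compress {f : V →ₗ[ZMod 2] ZMod 2} {g : V} (hg : f g = 1) (A : Finset V)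
    (p : V → Prop) [DecidablePred p] (hp : ∀ x, p (x + g) ↔ p x) :
    (compress f g A).filter p = compress f g (A.filter p) := by
  ext x
  simp only [Finset.mem_filter, mem_compress hg, hp]
  tauto

/-- Successive compressions in the directions of a list. -/
def compressList (f : V →ₗ[ZMod 2] ZMod 2) (l : List V) (A : Finset V) : Finset V :=
  l.foldl (fun B g => compress f g B) A

lemma compressList_cons (f : V →ₗ[ZMod 2] ZMod 2) (g : V) (l : List V) (A : Finset V) :
    compressList f (g :: l) A = compressList f l (compress f g A) := rfl

lemma card_filter_compressList {f : V →ₗ[ZMod 2] ZMod 2} {l : List V} (hl : ∀ g ∈ l, f g = 1)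
    (p : V → Prop) [DecidablePred p] (hp : ∀ g ∈ l, ∀ x, p (x + g) ↔ p x) (A : Finset V) :
    ((compressList f l A).filter p).card = (A.filter p).card := by
  induction l generalizing A with
  | nil => rfl
  | cons g l ih =>
    rw [compressList_cons, ih (fun k hk => hl k (List.mem_cons_of_mem _ hk))
      (fun k hk => hp k (List.mem_cons_of_mem _ hk)),
      filter_compress (hl g List.mem_cons_self) A p (hp g List.mem_cons_self),
      card_compress]

lemma card_compressList {f : V →ₗ[ZMod 2] ZMod 2} {l : List V} (hl : ∀ g ∈ l, f g = 1)
    (A : Finset V) : (compressList f l A).card = A.card := by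
  simpa using card_filter_compressList hl (fun _ => True) (fun _ _ _ => Iff.rfl) A

lemma card_compressList_add_le {f : V →ₗ[ZMod 2] ZMod 2} {l : List V} (hl : ∀ g ∈ l, f g = 1)
    (A B : Finset V) : (compressList f l A + compressList f l B).card ≤ (A + B).card := by
  induction l generalizing A B with
  | nil => rfl
  | cons g l ih =>
    exact (ih (fun k hk => hl k (List.mem_cons_of_mem _ hk)) _ _).trans
      (card_compress_add_le (hl g List.mem_cons_self) A B)

lemma mem_compressList_of_apply_eq_zero {f : V →ₗ[ZMod 2] ZMod 2} {l : List V}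
    (hl : ∀ g ∈ l, f g = 1) {A : Finset V} {x : V} (hx : x ∈ A) (h0 : f x = 0) :
    x ∈ compressList f l A := by
  induction l generalizing A with
  | nil => exact hx
  | cons g l ih =>
    exact ih (fun k hk => hl k (List.mem_cons_of_mem _ hk))
      ((mem_compress (hl g List.mem_cons_self)).2 (Or.inl ⟨h0, Or.inl hx⟩))

lemma mem_compressList_of_add_mem {f : V →ₗ[ZMod 2] ZMod 2} {l : List V}
    (hl : ∀ g ∈ l, f g = 1) {A : Finset V} {x : V} (hx : x ∈ A) (h1 : f x = 1)
    (h : ∀ g ∈ l, x + g ∈ A) : x ∈ compressList f l A := by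
  induction l generalizing A with
  | nil => exact hx
  | cons g l ih =>
    have hg := hl g List.mem_cons_self
    have hl' : ∀ k ∈ l, f k = 1 := fun k hk => hl k (List.mem_cons_of_mem _ hk)
    refine ih hl' ((mem_compress hg).2 (Or.inr ⟨h1, hx, h g List.mem_cons_self⟩)) fun k hk => ?_
    refine (mem_compress hg).2 (Or.inl ⟨?_, Or.inl (h k (List.mem_cons_of_mem _ hk))⟩)
    rw [map_add, h1, hl' k hk]; decide

lemma exists_add_mem_of_mem_compressList {f : V →ₗ[ZMod 2] ZMod 2} {l : List V}
    (hl : ∀ g ∈ l, f g = 1) {G : Submodule (ZMod 2) V} (hG : ∀ g ∈ l, g ∈ G) {A : Finset V} {x : V}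
    (hx : x ∈ compressList f l A) : ∃ g ∈ G, x + g ∈ A := by
  induction l generalizing A with
  | nil => exact ⟨0, G.zero_mem, by rw [add_zero]; exact hx⟩
  | cons g l ih =>
    obtain ⟨k, hk, hkA⟩ := ih (fun k hk => hl k (List.mem_cons_of_mem _ hk))
      (fun k hk => hG k (List.mem_cons_of_mem _ hk)) hx
    rcases (mem_compress (hl g List.mem_cons_self)).1 hkA with ⟨-, h | h⟩ | ⟨-, h, -⟩
    · exact ⟨k, hk, h⟩
    · exact ⟨k + g, G.add_mem hk (hG g List.mem_cons_self), by rwa [← add_assoc]⟩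
    · exact ⟨k, hk, h⟩

lemma exists_add_mem_compressList {f : V →ₗ[ZMod 2] ZMod 2} {l : List V}
    (hl : ∀ g ∈ l, f g = 1) {G : Submodule (ZMod 2) V} (hG : ∀ g ∈ l, g ∈ G) {A : Finset V} {x : V}
    (hx : x ∈ A) : ∃ g ∈ G, x + g ∈ compressList f l A := by
  induction l generalizing A x with
  | nil => exact ⟨0, G.zero_mem, by rw [add_zero]; exact hx⟩
  | cons g l ih =>
    have hg := hl g List.mem_cons_self
    have hl' : ∀ k ∈ l, f k = 1 := fun k hk => hl k (List.mem_cons_of_mem _ hk)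
    have hG' : ∀ k ∈ l, k ∈ G := fun k hk => hG k (List.mem_cons_of_mem _ hk)
    have key : x ∈ compress f g A ∨ x + g ∈ compress f g A := by
      rcases zmod_two_cases (f x) with h0 | h1
      · exact Or.inl ((mem_compress hg).2 (Or.inl ⟨h0, Or.inl hx⟩))
      · refine Or.inr ((mem_compress hg).2 (Or.inl ⟨?_, Or.inr ?_⟩))
        · rw [map_add, h1, hg]; decide
        · rwa [add_add_cancel_two]
    rcases key with h | h
    · exact ih hl' hG' h
    · obtain ⟨k, hk, hkA⟩ := ih hl' hG' h
      exact ⟨g + k, G.add_mem (hG g List.mem_cons_self) hk, by rwa [← add_assoc]⟩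

/-- Every coset of `Q` that is the shift by `w` of a coset met by `A` outside the kernel of `f` is
contained in `A`. -/
def IsStable (f : V →ₗ[ZMod 2] ZMod 2) (Q : Submodule (ZMod 2) V) (w : V) (A : Finset V) : Prop :=
  ∀ y ∈ A, f y = 1 → ∀ h ∈ Q, y + w + h ∈ A

lemma card_filter_compress_le {f : V →ₗ[ZMod 2] ZMod 2} {g : V} (hg : f g = 1) (A : Finset V) :
    ((compress f g A).filter (fun x => f x = 1)).card ≤ (A.filter (fun x => f x = 1)).card := by
  apply Finset.card_le_card
  intro x hx
  rw [Finset.mem_filter, mem_compress hg] at hx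
  rw [Finset.mem_filter]
  obtain ⟨⟨h0, -⟩ | ⟨-, h, -⟩, h1⟩ := hx
  · rw [h0] at h1; exact absurd h1 (by decide)
  · exact ⟨h, h1⟩

lemma card_filter_compress_lt {f : V →ₗ[ZMod 2] ZMod 2} {g : V} (hg : f g = 1) {A : Finset V}
    {y : V} (hy : y ∈ A) (h1 : f y = 1) (hyg : y + g ∉ A) :
    ((compress f g A).filter (fun x => f x = 1)).card < (A.filter (fun x => f x = 1)).card := by
  apply Finset.card_lt_card
  rw [Finset.ssubset_iff_of_subset]
  · refine ⟨y, Finset.mem_filter.2 ⟨hy, h1⟩, fun h => ?_⟩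
    rw [Finset.mem_filter, mem_compress hg] at h
    obtain ⟨⟨h0, -⟩ | ⟨-, -, h⟩, -⟩ := h
    · rw [h0] at h1; exact absurd h1 (by decide)
    · exact hyg h
  · intro x hx
    rw [Finset.mem_filter, mem_compress hg] at hx
    rw [Finset.mem_filter]
    obtain ⟨⟨h0, -⟩ | ⟨-, h, -⟩, h1⟩ := hx
    · rw [h0] at h1; exact absurd h1 (by decide)
    · exact ⟨h, h1⟩

/-- Any two sets can be made stable by the same list of compressions. -/
lemma exists_compressList_isStable {f : V →ₗ[ZMod 2] ZMod 2} {Q : Submodule (ZMod 2) V} {w : V}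
    (hQ : ∀ h ∈ Q, f h = 0) (hw : f w = 1) (A B : Finset V) :
    ∃ l : List V, (∀ g ∈ l, ∃ h ∈ Q, g = w + h) ∧ (∀ g ∈ l, f g = 1) ∧
      IsStable f Q w (compressList f l A) ∧ IsStable f Q w (compressList f l B) := by
  -- A compression chosen at a violation in one set strictly lowers that set's count of points off
  -- the kernel and never raises the other's.
  induction hn : (A.filter (fun x => f x = 1)).card + (B.filter (fun x => f x = 1)).card
    using Nat.strong_induction_on generalizing A B with
  | _ n ih =>
    subst hn
    have step : ∀ h ∈ Q, ((compress f (w + h) A).filter (fun x => f x = 1)).card +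
          ((compress f (w + h) B).filter (fun x => f x = 1)).card <
          (A.filter (fun x => f x = 1)).card + (B.filter (fun x => f x = 1)).card →
        ∃ l : List V, (∀ g ∈ l, ∃ h ∈ Q, g = w + h) ∧ (∀ g ∈ l, f g = 1) ∧
          IsStable f Q w (compressList f l A) ∧ IsStable f Q w (compressList f l B) := by
      intro h hh hlt
      obtain ⟨l, h1, h2, h3, h4⟩ := ih _ hlt _ _ rfl
      refine ⟨(w + h) :: l, ?_, ?_, h3, h4⟩
      · intro g hg
        rcases List.mem_cons.1 hg with rfl | hg
        · exact ⟨h, hh, rfl⟩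
        · exact h1 g hg
      · intro g hg
        rcases List.mem_cons.1 hg with rfl | hg
        · rw [map_add, hw, hQ h hh, add_zero]
        · exact h2 g hg
    have hf : ∀ h ∈ Q, f (w + h) = 1 := fun h hh => by rw [map_add, hw, hQ h hh, add_zero]
    by_cases hA : IsStable f Q w A
    · by_cases hB : IsStable f Q w B
      · exact ⟨[], by simp, by simp, hA, hB⟩
      · unfold IsStable at hB
        push Not at hB
        obtain ⟨y, hy, h1, h, hh, hyh⟩ := hB
        rw [add_assoc] at hyh
        exact step h hh (add_lt_add_of_le_of_lt (card_filter_compress_le (hf h hh) A)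
          (card_filter_compress_lt (hf h hh) hy h1 hyh))
    · unfold IsStable at hA
      push Not at hA
      obtain ⟨y, hy, h1, h, hh, hyh⟩ := hA
      rw [add_assoc] at hyh
      exact step h hh (add_lt_add_of_lt_of_le (card_filter_compress_lt (hf h hh) hy h1 hyh)
          (card_filter_compress_le (hf h hh) B))

end Compression

/-! ### Lower bounds for sumsets in elementary abelian 2-groups. -/

section SumsetBounds

variable {V : Type*} [AddCommGroup V] [Module (ZMod 2) V]

lemma exists_functional_eq_one {Q : Submodule (ZMod 2) V} {w : V} (hw : w ∉ Q) :
    ∃ f : V →ₗ[ZMod 2] ZMod 2, (∀ h ∈ Q, f h = 0) ∧ f w = 1 := by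
  obtain ⟨f, hfw, hf⟩ := Submodule.exists_le_ker_of_notMem hw
  exact ⟨f, fun h hh => LinearMap.mem_ker.1 (hf hh), (zmod_two_cases _).resolve_left hfw⟩

lemma natCard_eq_natCard_ker_mul {U W : Type*} [AddCommGroup U] [Module (ZMod 2) U]
    [AddCommGroup W] [Module (ZMod 2) W] (φ : U →ₗ[ZMod 2] W) (hφ : Function.Surjective φ) :
    Nat.card U = Nat.card (LinearMap.ker φ) * Nat.card W := by
  rw [Submodule.card_eq_card_quotient_mul_card (LinearMap.ker φ),
    Nat.card_congr (φ.quotKerEquivOfSurjective hφ).toEquiv]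

lemma natCard_eq_two_mul_inf_ker (P : Submodule (ZMod 2) V) {f : V →ₗ[ZMod 2] ZMod 2} {p : V}
    (hp : p ∈ P) (hfp : f p = 1) :
    Nat.card P = 2 * Nat.card (P ⊓ LinearMap.ker f : Submodule (ZMod 2) V) := by
  have hsurj : Function.Surjective (f.domRestrict P) := by
    intro c
    rcases zmod_two_cases c with rfl | rfl
    · exact ⟨0, map_zero _⟩
    · exact ⟨⟨p, hp⟩, hfp⟩
  rw [natCard_eq_natCard_ker_mul _ hsurj, Nat.card_zmod, mul_comm, LinearMap.ker_domRestrict,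
    show Submodule.comap P.subtype (LinearMap.ker f) =
      Submodule.comap P.subtype (P ⊓ LinearMap.ker f) by
        rw [Submodule.comap_inf, Submodule.comap_subtype_self, top_inf_eq],
    Nat.card_congr (Submodule.comapSubtypeEquivOfLe (inf_le_left : P ⊓ LinearMap.ker f ≤ P)).toEquiv]

/-- Two sets can be compressed along the hyperplane section `P ⊓ ker f` of a subgroup `P`. -/
lemma exists_compressed_pair [DecidableEq V] {P : Submodule (ZMod 2) V} {f : V →ₗ[ZMod 2] ZMod 2} {p : V}
    (hp : p ∈ P) (hfp : f p = 1) {X Y : Finset V} (hX : ∀ x ∈ X, x ∈ P) (hY : ∀ y ∈ Y, y ∈ P) :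
    ∃ X' Y' : Finset V, X'.card = X.card ∧ Y'.card = Y.card ∧ (X' + Y').card ≤ (X + Y).card ∧
      (∀ x ∈ X', x ∈ P) ∧ (∀ y ∈ Y', y ∈ P) ∧
      ((∃ x ∈ X', f x = 1) → ∀ h ∈ P ⊓ LinearMap.ker f, h ∈ X') ∧
      ((∃ y ∈ Y', f y = 1) → ∀ h ∈ P ⊓ LinearMap.ker f, h ∈ Y') := by
  obtain ⟨l, hl, hl1, hsX, hsY⟩ := exists_compressList_isStable (Q := P ⊓ LinearMap.ker f)
    (fun h hh => LinearMap.mem_ker.1 hh.2) hfp X Y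
  have hlP : ∀ g ∈ l, g ∈ P := by
    intro g hg
    obtain ⟨h, hh, rfl⟩ := hl g hg
    exact P.add_mem hp hh.1
  have hmem : ∀ {Z : Finset V}, (∀ z ∈ Z, z ∈ P) → ∀ z ∈ compressList f l Z, z ∈ P := by
    intro Z hZ z hz
    obtain ⟨g, hg, hzg⟩ := exists_add_mem_of_mem_compressList hl1 hlP hz
    exact (P.add_mem_iff_left hg).1 (hZ _ hzg)
  -- The part of `P` on which `f` vanishes is a single coset of `P ⊓ ker f`, so one outside point
  -- already fills it.
  have hst : ∀ {Z : Finset V}, (∀ z ∈ Z, z ∈ P) → IsStable f (P ⊓ LinearMap.ker f) p Z →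
      (∃ z ∈ Z, f z = 1) → ∀ h ∈ P ⊓ LinearMap.ker f, h ∈ Z := by
    rintro Z hZ hsZ ⟨z, hz, hfz⟩ h hh
    have hk : z + p + h ∈ P ⊓ LinearMap.ker f := by
      refine ⟨P.add_mem (P.add_mem (hZ z hz) hp) hh.1, LinearMap.mem_ker.2 ?_⟩
      rw [map_add, map_add, hfz, hfp, LinearMap.mem_ker.1 hh.2]; decide
    have := hsZ z hz hfz _ hk
    rwa [← add_assoc, ZModModule.add_self, zero_add] at this
  exact ⟨compressList f l X, compressList f l Y, card_compressList hl1 X, card_compressList hl1 Y,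
    card_compressList_add_le hl1 X Y, hmem hX, hmem hY, hst (hmem hX) hsX, hst (hmem hY) hsY⟩

variable [Finite V]

lemma card_le_natCard_of_forall_mem {P : Submodule (ZMod 2) V} {X : Finset V}
    (h : ∀ x ∈ X, x ∈ P) : X.card ≤ Nat.card P := by
  rw [← Set.ncard_coe_finset, ← SetLike.coe_sort_coe, Nat.card_coe_set_eq]
  exact Set.ncard_le_ncard h (Set.toFinite _)

lemma natCard_le_card_of_forall_mem {P : Submodule (ZMod 2) V} {X : Finset V}
    (h : ∀ x ∈ P, x ∈ X) : Nat.card P ≤ X.card := by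
  rw [← Set.ncard_coe_finset, ← SetLike.coe_sort_coe, Nat.card_coe_set_eq]
  exact Set.ncard_le_ncard h (Set.toFinite _)

lemma natCard_le_card_of_coset {P : Submodule (ZMod 2) V} {X : Finset V} (v : V)
    (h : ∀ x ∈ P, v + x ∈ X) : Nat.card P ≤ X.card := by
  classical
  rw [← Finset.card_image_of_injective X (add_right_injective (-v))]
  refine natCard_le_card_of_forall_mem fun x hx => Finset.mem_image.2 ⟨v + x, h x hx, ?_⟩
  rw [neg_add_cancel_left]

lemma exists_natCard_eq_two_pow (P : Submodule (ZMod 2) V) : ∃ k, Nat.card P = 2 ^ k := by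
  refine ⟨Module.finrank (ZMod 2) P, ?_⟩
  rw [Module.natCard_eq_pow_finrank (K := ZMod 2), Nat.card_zmod]

variable [DecidableEq V]

/-- Pigeonhole: `X` and `p - Y` both lie in `P` and are too large to be disjoint. -/
lemma mem_add_of_card_lt {P : Submodule (ZMod 2) V} {X Y : Finset V} (hX : ∀ x ∈ X, x ∈ P)
    (hY : ∀ y ∈ Y, y ∈ P) (h : Nat.card P < X.card + Y.card) {p : V} (hp : p ∈ P) :
    p ∈ X + Y := by
  by_contra hpn
  have hd : Disjoint X (Y.image (fun y => p - y)) := by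
    rw [Finset.disjoint_left]
    intro x hx hx'
    obtain ⟨y, hy, rfl⟩ := Finset.mem_image.1 hx'
    exact hpn (Finset.mem_add.2 ⟨_, hx, y, hy, sub_add_cancel _ _⟩)
  have h1 : (X ∪ Y.image (fun y => p - y)).card ≤ Nat.card P := by
    refine card_le_natCard_of_forall_mem fun x hx => ?_
    rcases Finset.mem_union.1 hx with hx | hx
    · exact hX x hx
    · obtain ⟨y, hy, rfl⟩ := Finset.mem_image.1 hx
      exact P.sub_mem hp (hY y hy)
  rw [Finset.card_union_of_disjoint hd,
    Finset.card_image_of_injective _ (sub_right_injective (b := p))] at h1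
  omega

/-- In an elementary abelian `2`-group, `2 ^ j < |X| + |Y|` forces `2 ^ j ≤ |X + Y|`. -/
lemma two_pow_le_card_add {P : Submodule (ZMod 2) V} {X Y : Finset V} (hX : ∀ x ∈ X, x ∈ P)
    (hY : ∀ y ∈ Y, y ∈ P) (hXn : X.Nonempty) (hYn : Y.Nonempty) {j : ℕ}
    (h : 2 ^ j < X.card + Y.card) : 2 ^ j ≤ (X + Y).card := by
  obtain ⟨k, hk⟩ := exists_natCard_eq_two_pow P
  induction k generalizing P X Y with
  | zero =>
    have h1 := card_le_natCard_of_forall_mem hX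
    have h2 := card_le_natCard_of_forall_mem hY
    have h3 : (X + Y).Nonempty := hXn.add hYn
    have h4 := h3.card_pos
    rw [hk, pow_zero] at h1 h2
    omega
  | succ k ih =>
    by_cases hj : k + 1 ≤ j
    · have hPj : Nat.card P ≤ 2 ^ j := hk ▸ Nat.pow_le_pow_right (by norm_num) hj
      have h1 := card_le_natCard_of_forall_mem hX
      have h2 := card_le_natCard_of_forall_mem hY
      have h3 : j < k + 2 := by
        refine (Nat.pow_lt_pow_iff_right (a := 2) (by norm_num)).1 ?_
        rw [pow_succ 2 (k + 1), ← hk]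
        omega
      -- Here `|X| + |Y|` exceeds `|P|`, so the sumset is all of `P`.
      obtain rfl : j = k + 1 := by omega
      rw [← hk] at h ⊢
      exact natCard_le_card_of_forall_mem fun p hp => mem_add_of_card_lt hX hY h hp
    · have hne : P ≠ ⊥ := by
        rintro rfl
        rw [Nat.card_unique] at hk
        have := Nat.one_lt_two_pow (n := k + 1) (by omega)
        omega
      obtain ⟨p, hp, hp0⟩ := Submodule.exists_mem_ne_zero_of_ne_bot hne
      obtain ⟨f, -, hfp⟩ := exists_functional_eq_one (Q := ⊥) (w := p) (by simpa using hp0)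
      obtain ⟨X', Y', hX'c, hY'c, hle, hX', hY', hsX, hsY⟩ := exists_compressed_pair hp hfp hX hY
      have hX'n : X'.Nonempty := Finset.card_pos.1 (hX'c ▸ hXn.card_pos)
      have hY'n : Y'.Nonempty := Finset.card_pos.1 (hY'c ▸ hYn.card_pos)
      have hcard := natCard_eq_two_mul_inf_ker P hp hfp
      have hQ : Nat.card (P ⊓ LinearMap.ker f : Submodule (ZMod 2) V) = 2 ^ k := by
        rw [hk, pow_succ] at hcard; omega
      have hjk : 2 ^ j ≤ 2 ^ k := Nat.pow_le_pow_right (by norm_num) (by omega)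
      refine le_trans ?_ hle
      -- If either compressed set leaves the hyperplane it contains the whole hyperplane, which has
      -- `2 ^ k ≥ 2 ^ j` points. Otherwise both lie in it and the dimension drops.
      by_cases hx : ∃ x ∈ X', f x = 1
      · exact (hjk.trans (hQ ▸ natCard_le_card_of_forall_mem (hsX hx))).trans
          (Finset.card_le_card_add_right hY'n)
      by_cases hy : ∃ y ∈ Y', f y = 1
      · exact (hjk.trans (hQ ▸ natCard_le_card_of_forall_mem (hsY hy))).trans
          (Finset.card_le_card_add_left hX'n)
      push Not at hx hy
      exact ih (P := P ⊓ LinearMap.ker f)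
        (fun x h => ⟨hX' x h, LinearMap.mem_ker.2 ((zmod_two_cases _).resolve_right (hx x h))⟩)
        (fun y h => ⟨hY' y h, LinearMap.mem_ker.2 ((zmod_two_cases _).resolve_right (hy y h))⟩)
        hX'n hY'n (by rwa [hX'c, hY'c]) hQ

/-- If `X` fills more than half of the subgroup `P` and the nonempty set `Y` at most half of it, then
`X + Y` has at least `|P| / 2 + |Y|` elements. -/
lemma natCard_add_two_mul_card_le {P : Submodule (ZMod 2) V} {X Y : Finset V}
    (hX : ∀ x ∈ X, x ∈ P) (hY : ∀ y ∈ Y, y ∈ P) (hYn : Y.Nonempty)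
    (hXc : Nat.card P < 2 * X.card) (hYc : 2 * Y.card ≤ Nat.card P) :
    Nat.card P + 2 * Y.card ≤ 2 * (X + Y).card := by
  have hne : P ≠ ⊥ := by
    rintro rfl
    rw [Nat.card_unique] at hYc
    have := hYn.card_pos
    omega
  obtain ⟨p, hp, hp0⟩ := Submodule.exists_mem_ne_zero_of_ne_bot hne
  obtain ⟨f, -, hfp⟩ := exists_functional_eq_one (Q := ⊥) (w := p) (by simpa using hp0)
  obtain ⟨X', Y', hX'c, hY'c, hle, hX', hY', hsX, hsY⟩ := exists_compressed_pair hp hfp hX hY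
  have hcard := natCard_eq_two_mul_inf_ker P hp hfp
  have hY'n : Y'.Nonempty := Finset.card_pos.1 (hY'c ▸ hYn.card_pos)
  have hx : ∃ x ∈ X', f x = 1 := by
    by_contra hx
    push Not at hx
    have := card_le_natCard_of_forall_mem (P := P ⊓ LinearMap.ker f) (X := X')
      (fun x h => ⟨hX' x h, LinearMap.mem_ker.2 ((zmod_two_cases _).resolve_right (hx x h))⟩)
    omega
  have hQX := hsX hx
  -- A point of `Y'` off the hyperplane would force the whole hyperplane into `Y'`, giving more than
  -- `|P| / 2` points.
  have hy : ∀ y ∈ Y', f y = 0 := by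
    by_contra hy
    push Not at hy
    obtain ⟨y, hy, hfy⟩ := hy
    have hfy := (zmod_two_cases _).resolve_left hfy
    have h1 := natCard_le_card_of_forall_mem (P := P ⊓ LinearMap.ker f) (X := Y'.erase y)
      (fun h hh => Finset.mem_erase.2 ⟨by
        rintro rfl
        rw [LinearMap.mem_ker.1 hh.2] at hfy
        exact absurd hfy (by decide), hsY ⟨y, hy, hfy⟩ h hh⟩)
    rw [Finset.card_erase_of_mem hy] at h1
    have := hY'n.card_pos
    omega
  -- Since `X'` contains the hyperplane and a point `x` off it, the sumset contains a full
  -- hyperplane and, on the other side, the translate `x + Y'`.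
  have h0 : Nat.card (P ⊓ LinearMap.ker f : Submodule (ZMod 2) V) ≤
      ((X' + Y').filter (fun x => f x = 0)).card := by
    obtain ⟨y, hyY⟩ := hY'n
    refine natCard_le_card_of_coset y fun q hq => Finset.mem_filter.2 ⟨?_, ?_⟩
    · rw [add_comm y]
      exact Finset.add_mem_add (hQX q hq) hyY
    · rw [map_add, hy y hyY, LinearMap.mem_ker.1 hq.2, add_zero]
  have h1 : Y'.card ≤ ((X' + Y').filter (fun x => ¬ f x = 0)).card := by
    obtain ⟨x, hxX, hfx⟩ := hx
    rw [← Finset.card_image_of_injective Y' (add_right_injective x)]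
    refine Finset.card_le_card fun z hz => ?_
    obtain ⟨y, hyY, rfl⟩ := Finset.mem_image.1 hz
    refine Finset.mem_filter.2 ⟨Finset.add_mem_add hxX hyY, ?_⟩
    rw [map_add, hfx, hy y hyY]; decide
  have h2 := Finset.card_filter_add_card_filter_not (s := X' + Y') (fun x => f x = 0)
  omega

end SumsetBounds

/-! ### Extremal generating sets and their reduction to stars. -/

section Structure

variable {V : Type*} [AddCommGroup V] [Module (ZMod 2) V]

/-- No proper affine subspace contains `A`. -/
def AffinelyGenerates (A : Finset V) : Prop :=
  ∀ φ : V →ₗ[ZMod 2] ZMod 2, (∀ a ∈ A, ∀ b ∈ A, φ a = φ b) → φ = 0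

lemma exists_max_of_bounded {P : ℕ → Prop} {b n : ℕ} (hn : P n) (hb : ∀ m, P m → m ≤ b) :
    ∃ m, P m ∧ ∀ k, P k → k ≤ m := by
  classical
  exact ⟨Nat.findGreatest P b, Nat.findGreatest_spec (hb n hn) hn,
    fun k hk => Nat.le_findGreatest (hb k hk) hk⟩

lemma mem_or_add_mem_of_mem_sup_span {H : Submodule (ZMod 2) V} {v k : V}
    (hk : k ∈ H ⊔ Submodule.span (ZMod 2) {v}) : k ∈ H ∨ k + v ∈ H := by
  obtain ⟨h, hh, u, hu, rfl⟩ := Submodule.mem_sup.1 hk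
  obtain ⟨c, rfl⟩ := Submodule.mem_span_singleton.1 hu
  rcases zmod_two_cases c with rfl | rfl
  · left; rwa [zero_smul, add_zero]
  · right; rwa [one_smul, add_add_cancel_two]

lemma mem_of_mem_sup_span_of_apply_eq_zero {H : Submodule (ZMod 2) V} {v k : V}
    {f : V →ₗ[ZMod 2] ZMod 2} (hf : ∀ h ∈ H, f h = 0) (hfv : f v = 1)
    (hk : k ∈ H ⊔ Submodule.span (ZMod 2) {v}) (hfk : f k = 0) : k ∈ H := by
  refine (mem_or_add_mem_of_mem_sup_span hk).resolve_right fun h => ?_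
  have := hf _ h
  rw [map_add, hfk, hfv] at this
  exact absurd this (by decide)

lemma apply_eq_zero_of_mem_sup_span {H : Submodule (ZMod 2) V} {v k : V}
    {f : V →ₗ[ZMod 2] ZMod 2} (hf : ∀ h ∈ H, f h = 0) (hfv : f v = 0)
    (hk : k ∈ H ⊔ Submodule.span (ZMod 2) {v}) : f k = 0 := by
  rcases mem_or_add_mem_of_mem_sup_span hk with h | h
  · exact hf k h
  · have := hf _ h
    rwa [map_add, hfv, add_zero] at this

lemma two_mul_natCard_le_natCard_sup_span [Finite V] {H : Submodule (ZMod 2) V} {v : V}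
    (hv : v ∉ H) : 2 * Nat.card H ≤ Nat.card (H ⊔ Submodule.span (ZMod 2) {v} :
      Submodule (ZMod 2) V) := by
  obtain ⟨f, hf, hfv⟩ := exists_functional_eq_one hv
  rw [natCard_eq_two_mul_inf_ker _
    (Submodule.mem_sup_right (Submodule.mem_span_singleton_self v)) hfv]
  exact Nat.mul_le_mul_left 2 (Nat.card_mono (Set.toFinite _)
    fun h hh => ⟨Submodule.mem_sup_left hh, LinearMap.mem_ker.2 (hf h hh)⟩)

/-- `A` contains `H`, and its elements outside the common kernel of the functionals `f i` lie in the
cosets `w i + H`, where `f` is dual to `w` modulo `H`. -/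
structure IsPartialStar (H : Submodule (ZMod 2) V) (A : Finset V) {j : ℕ} (w : Fin j → V)
    (f : Fin j → V →ₗ[ZMod 2] ZMod 2) : Prop where
  subset : ∀ h ∈ H, h ∈ A
  map_sub : ∀ i, ∀ h ∈ H, f i h = 0
  map_self : ∀ i, f i (w i) = 1
  map_ne : ∀ i k, i ≠ k → f i (w k) = 0
  mem : ∀ i, w i ∈ A
  add_mem : ∀ i, ∀ x ∈ A, f i x = 1 → x + w i ∈ H

lemma IsPartialStar.le_natCard [Finite V] {H : Submodule (ZMod 2) V} {A : Finset V} {j : ℕ}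
    {w : Fin j → V} {f : Fin j → V →ₗ[ZMod 2] ZMod 2} (hs : IsPartialStar H A w f) :
    j ≤ Nat.card V := by
  have hinj : Function.Injective w := by
    intro i k hik
    by_contra hne
    have h1 := hs.map_self i
    rw [hik, hs.map_ne i k hne] at h1
    exact absurd h1 (by decide)
  simpa using Nat.card_le_card_of_injective w hinj

/-- A functional that detects an element in the common kernel of a partial star. -/
lemma IsPartialStar.exists_functional {H : Submodule (ZMod 2) V} {A : Finset V} {j : ℕ}
    {w : Fin j → V} {f : Fin j → V →ₗ[ZMod 2] ZMod 2} (hs : IsPartialStar H A w f) {x : V}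
    (hx : ∀ i, f i x = 0) (hxH : x ∉ H) :
    ∃ φ : V →ₗ[ZMod 2] ZMod 2, (∀ h ∈ H, φ h = 0) ∧ (∀ i, φ (w i) = 0) ∧ φ x = 1 := by
  have hn : x ∉ H ⊔ Submodule.span (ZMod 2) (Set.range w) := by
    intro hmem
    obtain ⟨h, hh, u, hu, rfl⟩ := Submodule.mem_sup.1 hmem
    obtain ⟨c, rfl⟩ := (Submodule.mem_span_range_iff_exists_fun _).1 hu
    have hc : ∀ i, c i = 0 := by
      intro i
      have h1 := hx i
      rw [map_add, hs.map_sub i h hh, zero_add, map_sum, Finset.sum_eq_single i] at h1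
      · rwa [map_smul, hs.map_self, smul_eq_mul, mul_one] at h1
      · intro k _ hk
        rw [map_smul, hs.map_ne i k hk.symm, smul_zero]
      · exact fun hi => absurd (Finset.mem_univ i) hi
    apply hxH
    simpa [hc] using hh
  obtain ⟨φ, hφ, hφx⟩ := exists_functional_eq_one hn
  exact ⟨φ, fun h hh => hφ h (Submodule.mem_sup_left hh),
    fun i => hφ _ (Submodule.mem_sup_right (Submodule.subset_span ⟨i, rfl⟩)), hφx⟩

variable [DecidableEq V]

/-- `A` affinely generates, and no affinely generating set of the same cardinality with at most as
large a sumset contains a coset of a subgroup with more than `N` elements. -/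
def IsExtremal (A : Finset V) (N : ℕ) : Prop :=
  AffinelyGenerates A ∧ ∀ B : Finset V, AffinelyGenerates B → B.card = A.card →
    (B + B).card ≤ (A + A).card →
      ∀ (K : Submodule (ZMod 2) V) (v : V), (∀ k ∈ K, v + k ∈ B) → Nat.card K ≤ N

lemma IsExtremal.of_card_eq {A B : Finset V} {N : ℕ} (hA : IsExtremal A N)
    (hB : AffinelyGenerates B) (hc : B.card = A.card) (hs : (B + B).card ≤ (A + A).card) :
    IsExtremal B N :=
  ⟨hB, fun C hC hCc hCs => hA.2 C hC (hCc.trans hc) (hCs.trans hs)⟩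

/-- Two distinct cosets `H` and `v + H` inside `A` would form a subgroup of order `2 |H|`, against
extremality. -/
lemma IsExtremal.mem_of_coset [Finite V] {A : Finset V} {H : Submodule (ZMod 2) V}
    (hA : IsExtremal A (Nat.card H)) (hH : ∀ h ∈ H, h ∈ A) {v : V} (hv : ∀ h ∈ H, v + h ∈ A) :
    v ∈ H := by
  by_contra hvH
  have h1 := two_mul_natCard_le_natCard_sup_span hvH
  have h2 := hA.2 A hA.1 rfl le_rfl (H ⊔ Submodule.span (ZMod 2) {v}) 0 (by
    intro k hk
    rw [zero_add]
    rcases mem_or_add_mem_of_mem_sup_span hk with h | h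
    · exact hH k h
    · have := hv _ h
      rwa [add_comm, add_add_cancel_two] at this)
  have h3 : 0 < Nat.card H := Nat.card_pos
  omega

/-- The order of the subgroup is maximised jointly over the subgroup, the translate and the set. The
optimal set is then translated by `v`, which changes neither cardinality nor generation and turns
the coset into the subgroup. -/
lemma exists_isExtremal [Finite V] {A : Finset V} (hA : AffinelyGenerates A) (hne : A.Nonempty) :
    ∃ (H : Submodule (ZMod 2) V) (B : Finset V), IsExtremal B (Nat.card H) ∧ B.card = A.card ∧
      (B + B).card ≤ (A + A).card ∧ ∀ h ∈ H, h ∈ B := by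
  obtain ⟨N, ⟨K, v, B, rfl, hB, hc, hs, hK⟩, hmax⟩ := exists_max_of_bounded (n := 1) (b := A.card)
    (P := fun N => ∃ (K : Submodule (ZMod 2) V) (v : V) (B : Finset V), Nat.card K = N ∧
      AffinelyGenerates B ∧ B.card = A.card ∧ (B + B).card ≤ (A + A).card ∧ ∀ k ∈ K, v + k ∈ B)
    (by
      obtain ⟨a, ha⟩ := hne
      refine ⟨⊥, a, A, Nat.card_unique, hA, rfl, le_rfl, fun k hk => ?_⟩
      rw [(Submodule.mem_bot _).1 hk, add_zero]
      exact ha)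
    (by
      rintro N ⟨K, v, B, rfl, -, hc, -, hK⟩
      exact hc ▸ natCard_le_card_of_coset v hK)
  have hc' : ({v} + B).card = B.card := Finset.card_singleton_add _ _
  have hs' : (({v} + B) + ({v} + B)).card = (B + B).card := by
    rw [add_add_add_comm, Finset.singleton_add_singleton, Finset.card_singleton_add]
  refine ⟨K, {v} + B, ⟨?_, ?_⟩, hc'.trans hc, by rw [hs']; exact hs, fun h hh => ?_⟩
  · intro φ hφ
    refine hB φ fun a ha b hb => ?_
    have := hφ (v + a) (Finset.add_mem_add (Finset.mem_singleton_self v) ha) (v + b)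
      (Finset.add_mem_add (Finset.mem_singleton_self v) hb)
    rwa [map_add, map_add, add_right_inj] at this
  · intro C hC hCc hCs L u hL
    exact hmax (Nat.card L) ⟨L, u, C, rfl, hC, hCc.trans (hc'.trans hc), (hCs.trans_eq hs').trans hs, hL⟩
  · refine Finset.mem_add.2 ⟨v, Finset.mem_singleton_self v, v + h, hK h hh, ?_⟩
    rw [← add_assoc, ZModModule.add_self, zero_add]

/-- Points move only within cosets of `G`, so a functional that vanishes on `G` and is constant on
the compressed set is constant on `A`. -/
lemma AffinelyGenerates.compressList {f : V →ₗ[ZMod 2] ZMod 2} {l : List V}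
    (hl : ∀ g ∈ l, f g = 1) {G : Submodule (ZMod 2) V} (hG : ∀ g ∈ l, g ∈ G) {A : Finset V}
    (hA : AffinelyGenerates A)
    (h : ∀ φ : V →ₗ[ZMod 2] ZMod 2, (∀ a ∈ compressList f l A, ∀ b ∈ compressList f l A, φ a = φ b) →
      ∀ g ∈ G, φ g = 0) : AffinelyGenerates (compressList f l A) := by
  intro φ hφ
  refine hA φ fun a ha b hb => ?_
  obtain ⟨g, hg, hga⟩ := exists_add_mem_compressList hl hG ha
  obtain ⟨k, hk, hkb⟩ := exists_add_mem_compressList hl hG hb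
  have := hφ _ hga _ hkb
  rwa [map_add, map_add, h φ hφ g hg, h φ hφ k hk, add_zero, add_zero] at this

/-- A functional `φ` that vanishes on `H` and the old arms but not at `x` guides a compression in
the directions `x + H`. The point `x` survives because its possible destinations already lie in `H ⊆
A`. -/
lemma IsPartialStar.exists_succ [Finite V] {H : Submodule (ZMod 2) V} {A : Finset V} {j : ℕ}
    {w : Fin j → V} {f : Fin j → V →ₗ[ZMod 2] ZMod 2} (hs : IsPartialStar H A w f)
    (hA : IsExtremal A (Nat.card H)) {x : V} (hxA : x ∈ A) (hx : ∀ i, f i x = 0) (hxH : x ∉ H) :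
    ∃ (B : Finset V) (w' : Fin (j + 1) → V) (f' : Fin (j + 1) → V →ₗ[ZMod 2] ZMod 2),
      IsExtremal B (Nat.card H) ∧ B.card = A.card ∧ (B + B).card ≤ (A + A).card ∧
      IsPartialStar H B w' f' := by
  obtain ⟨φ, hφH, hφw, hφx⟩ := hs.exists_functional hx hxH
  obtain ⟨l, hl, hl1, hst, -⟩ := exists_compressList_isStable hφH hφx A A
  set G := H ⊔ Submodule.span (ZMod 2) {x} with hGdef
  have hxG : x ∈ G := Submodule.mem_sup_right (Submodule.mem_span_singleton_self x)
  have hlG : ∀ g ∈ l, g ∈ G := by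
    intro g hg
    obtain ⟨h, hh, rfl⟩ := hl g hg
    exact G.add_mem hxG (Submodule.mem_sup_left hh)
  have hHB : ∀ h ∈ H, h ∈ _root_.compressList φ l A := fun h hh =>
    mem_compressList_of_apply_eq_zero hl1 (hs.subset h hh) (hφH h hh)
  have hxB : x ∈ _root_.compressList φ l A := by
    refine mem_compressList_of_add_mem hl1 hxA hφx fun g hg => ?_
    obtain ⟨h, hh, rfl⟩ := hl g hg
    rw [← add_assoc, ZModModule.add_self, zero_add]
    exact hs.subset h hh
  have hB : IsExtremal (_root_.compressList φ l A) (Nat.card H) := by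
    refine hA.of_card_eq (hA.1.compressList hl1 hlG fun ψ hψ g hg => ?_) (card_compressList hl1 A)
      (card_compressList_add_le hl1 A A)
    have h0 : ∀ b ∈ _root_.compressList φ l A, ψ b = 0 := fun b hb => by
      rw [hψ b hb 0 (hHB 0 H.zero_mem), map_zero]
    exact apply_eq_zero_of_mem_sup_span (fun h hh => h0 h (hHB h hh)) (h0 x hxB) hg
  -- Stability puts the coset `y + x + H` into the compressed set, and extremality identifies it
  -- with `H`.
  have hone : ∀ y ∈ _root_.compressList φ l A, φ y = 1 → y + x ∈ H := fun y hy hy1 =>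
    hB.mem_of_coset hHB (hst y hy hy1)
  refine ⟨_, Fin.cons x w, Fin.cons φ f, hB, card_compressList hl1 A,
    card_compressList_add_le hl1 A A, hHB, ?_, ?_, ?_, ?_, ?_⟩
  · exact Fin.cases hφH hs.map_sub
  · exact Fin.cases hφx hs.map_self
  · intro i k hik
    induction i using Fin.cases with
    | zero =>
      induction k using Fin.cases with
      | zero => exact absurd rfl hik
      | succ k => exact hφw k
    | succ i =>
      induction k using Fin.cases with
      | zero => exact hx i
      | succ k => exact hs.map_ne i k (fun h => hik (h ▸ rfl))
  · exact Fin.cases hxB fun i => mem_compressList_of_apply_eq_zero hl1 (hs.mem i) (hφw i)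
  · refine Fin.cases hone fun i y hy hy1 => ?_
    simp only [Fin.cons_succ] at hy1 ⊢
    -- Old arms stay in their cosets: moves lie in `G`, where `f i` vanishes, so `y + w i ∈ G`, and
    -- `φ` brings it back to `H`.
    rcases zmod_two_cases (φ y) with h0 | h1
    · obtain ⟨g, hg, hyg⟩ := exists_add_mem_of_mem_compressList hl1 hlG hy
      have hfg : f i g = 0 := apply_eq_zero_of_mem_sup_span (hs.map_sub i) (hx i) hg
      have h2 := hs.add_mem i _ hyg (by rw [map_add, hy1, hfg, add_zero])
      rw [add_right_comm] at h2
      refine mem_of_mem_sup_span_of_apply_eq_zero hφH hφx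
        ((G.add_mem_iff_left hg).1 (Submodule.mem_sup_left h2)) ?_
      rw [map_add, h0, hφw, add_zero]
    · have h2 := hs.map_sub i _ (hone y hy h1)
      rw [map_add, hy1, hx i, add_zero] at h2
      exact absurd h2 (by decide)

/-- Compressing in the directions `w i + w k + H` merges arm `i` into arm `k`. With more than `|H|`
points in total they overflow, and stability makes `w k + H` full next to `H`, contradicting
extremality. -/
lemma IsPartialStar.card_add_card_le [Finite V] {H : Submodule (ZMod 2) V} {A : Finset V} {j : ℕ}
    {w : Fin j → V} {f : Fin j → V →ₗ[ZMod 2] ZMod 2} (hs : IsPartialStar H A w f)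
    (hA : IsExtremal A (Nat.card H)) {i k : Fin j} (hik : i ≠ k) :
    (A.filter (fun x => f i x = 1)).card + (A.filter (fun x => f k x = 1)).card ≤ Nat.card H := by
  classical
  by_contra hlt
  push Not at hlt
  have hfw : f i (w i + w k) = 1 := by
    rw [map_add, hs.map_self, hs.map_ne i k hik, add_zero]
  obtain ⟨l, hl, hl1, hst, -⟩ := exists_compressList_isStable (hs.map_sub i) hfw A A
  set G := H ⊔ Submodule.span (ZMod 2) {w i + w k} with hGdef
  have hwG : w i + w k ∈ G := Submodule.mem_sup_right (Submodule.mem_span_singleton_self _)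
  have hlG : ∀ g ∈ l, g ∈ G := by
    intro g hg
    obtain ⟨h, hh, rfl⟩ := hl g hg
    exact G.add_mem hwG (Submodule.mem_sup_left hh)
  have hp : ∀ g ∈ l, ∀ x, x + g + w k ∈ G ↔ x + w k ∈ G := by
    intro g hg x
    rw [add_right_comm]
    exact G.add_mem_iff_left (hlG g hg)
  have hcard := card_filter_compressList hl1 (fun x => x + w k ∈ G) hp A
  have hdisj : Disjoint (A.filter (fun x => f i x = 1)) (A.filter (fun x => f k x = 1)) := by
    rw [Finset.disjoint_left]
    intro x hxi hxk
    rw [Finset.mem_filter] at hxi hxk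
    have := hs.map_sub k _ (hs.add_mem i x hxi.1 hxi.2)
    rw [map_add, hxk.2, hs.map_ne k i hik.symm, add_zero] at this
    exact absurd this (by decide)
  have hsub : A.filter (fun x => f i x = 1) ∪ A.filter (fun x => f k x = 1) ⊆
      A.filter (fun x => x + w k ∈ G) := by
    intro x hx
    rw [Finset.mem_union, Finset.mem_filter, Finset.mem_filter] at hx
    rw [Finset.mem_filter]
    rcases hx with ⟨hxA, hx1⟩ | ⟨hxA, hx1⟩
    · refine ⟨hxA, ?_⟩
      have h2 := G.add_mem (Submodule.mem_sup_left (hs.add_mem i x hxA hx1)) hwG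
      rwa [← add_assoc, add_add_cancel_two] at h2
    · exact ⟨hxA, Submodule.mem_sup_left (hs.add_mem k x hxA hx1)⟩
  have hlt' : Nat.card H < ((_root_.compressList (f i) l A).filter (fun x => x + w k ∈ G)).card := by
    rw [hcard]
    refine hlt.trans_le ?_
    rw [← Finset.card_union_of_disjoint hdisj]
    exact Finset.card_le_card hsub
  -- The coset `w k + G` consists of `w k + H` and `w i + H`; it carries more than `|H|` points, so
  -- some point remains in the second.
  obtain ⟨z, hzB, hzG, hz1⟩ : ∃ z ∈ _root_.compressList (f i) l A, z + w k ∈ G ∧ f i z = 1 := by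
    by_contra hno
    push Not at hno
    refine absurd hlt' (not_lt.2 ?_)
    rw [← Finset.card_image_of_injective _ (add_left_injective (w k))]
    refine card_le_natCard_of_forall_mem fun x hx => ?_
    obtain ⟨y, hy, rfl⟩ := Finset.mem_image.1 hx
    rw [Finset.mem_filter] at hy
    refine mem_of_mem_sup_span_of_apply_eq_zero (hs.map_sub i) hfw hy.2 ?_
    rw [map_add, hs.map_ne i k hik, add_zero]
    exact (zmod_two_cases _).resolve_right (hno y hy.1 hy.2)
  have hzH : z + w k + (w i + w k) ∈ H := by
    refine mem_of_mem_sup_span_of_apply_eq_zero (hs.map_sub i) hfw (G.add_mem hzG hwG) ?_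
    rw [map_add, map_add, hz1, hs.map_ne i k hik, hfw]; decide
  have hHB : ∀ h ∈ H, h ∈ _root_.compressList (f i) l A := fun h hh =>
    mem_compressList_of_apply_eq_zero hl1 (hs.subset h hh) (hs.map_sub i h hh)
  have hwB : ∀ h ∈ H, w k + h ∈ _root_.compressList (f i) l A := by
    intro h hh
    have := hst z hzB hz1 _ (H.add_mem hzH hh)
    have e : z + (w i + w k) + (z + w k + (w i + w k) + h) =
        (z + z) + ((w i + w k) + (w i + w k)) + (w k + h) := by abel
    rwa [e, ZModModule.add_self, ZModModule.add_self, zero_add, zero_add] at this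
  have hB : IsExtremal (_root_.compressList (f i) l A) (Nat.card H) := by
    refine hA.of_card_eq (hA.1.compressList hl1 hlG fun ψ hψ g hg => ?_) (card_compressList hl1 A)
      (card_compressList_add_le hl1 A A)
    have h0 : ∀ b ∈ _root_.compressList (f i) l A, ψ b = 0 := fun b hb => by
      rw [hψ b hb 0 (hHB 0 H.zero_mem), map_zero]
    refine apply_eq_zero_of_mem_sup_span (fun h hh => h0 h (hHB h hh)) ?_ hg
    have h1 := h0 _ (hHB _ hzH)
    have h2 := h0 _ (hwB 0 H.zero_mem)
    rw [add_zero] at h2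
    rwa [map_add, map_add, h0 z hzB, h2, zero_add, zero_add] at h1
  have h1 := hs.map_sub k _ (hB.mem_of_coset hHB hwB)
  rw [hs.map_self] at h1
  exact absurd h1 (by decide)

/-- Compression turns every affinely generating set into a subgroup `H` together with subsets of
cosets of `H` in independent directions, any two of which have at most `|H|` elements. -/
theorem exists_star [Finite V] {A : Finset V} (hA : AffinelyGenerates A) (hne : A.Nonempty) :
    ∃ (H : Submodule (ZMod 2) V) (B : Finset V) (M : ℕ) (w : Fin M → V)
      (f : Fin M → V →ₗ[ZMod 2] ZMod 2), B.card = A.card ∧ (B + B).card ≤ (A + A).card ∧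
      IsPartialStar H B w f ∧ (∀ x ∈ B, (∀ i, f i x = 0) → x ∈ H) ∧
      Nat.card V = Nat.card H * 2 ^ M ∧
      ∀ i k, i ≠ k → (B.filter (fun x => f i x = 1)).card + (B.filter (fun x => f k x = 1)).card ≤
        Nat.card H := by
  obtain ⟨H, A₀, hA₀, hc₀, hs₀, hHA₀⟩ := exists_isExtremal hA hne
  obtain ⟨B, M, w, f, hB, hBc, hBs, hstar, hend⟩ : ∃ (B : Finset V) (M : ℕ) (w : Fin M → V)
      (f : Fin M → V →ₗ[ZMod 2] ZMod 2), IsExtremal B (Nat.card H) ∧ B.card = A.card ∧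
      (B + B).card ≤ (A + A).card ∧ IsPartialStar H B w f ∧
      ∀ x ∈ B, (∀ i, f i x = 0) → x ∈ H := by
    -- If no partial star were complete, arms could be added indefinitely, but the `w i` are
    -- distinct elements of `V`.
    by_contra hno
    push Not at hno
    have hall : ∀ M : ℕ, ∃ (B : Finset V) (w : Fin M → V) (f : Fin M → V →ₗ[ZMod 2] ZMod 2),
        IsExtremal B (Nat.card H) ∧ B.card = A.card ∧ (B + B).card ≤ (A + A).card ∧
        IsPartialStar H B w f := by
      intro M
      induction M with
      | zero =>
        exact ⟨A₀, Fin.elim0, Fin.elim0, hA₀, hc₀, hs₀, hHA₀, fun i => i.elim0, fun i => i.elim0,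
          fun i => i.elim0, fun i => i.elim0, fun i => i.elim0⟩
      | succ M ih =>
        obtain ⟨B, w, f, hB, hBc, hBs, hstar⟩ := ih
        obtain ⟨x, hxB, hx, hxH⟩ := hno B M w f hB hBc hBs hstar
        obtain ⟨B', w', f', hB', hBc', hBs', hstar'⟩ := hstar.exists_succ hB hxB hx hxH
        exact ⟨B', w', f', hB', hBc'.trans hBc, hBs'.trans hBs, hstar'⟩
    obtain ⟨B, w, f, -, -, -, hstar⟩ := hall (Nat.card V + 1)
    have := hstar.le_natCard
    omega
  refine ⟨H, B, M, w, f, hBc, hBs, hstar, hend, ?_, fun i k hik => hstar.card_add_card_le hB hik⟩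
  -- A point of the kernel outside `H` would be detected by a functional vanishing on `H` and every
  -- arm, hence on the generating set `B`.
  have hker : LinearMap.ker (LinearMap.pi f) = H := by
    ext x
    rw [LinearMap.mem_ker]
    constructor
    · intro hx
      have hx' : ∀ i, f i x = 0 := fun i => congrFun hx i
      by_contra hxH
      obtain ⟨φ, hφH, hφw, hφx⟩ := hstar.exists_functional hx' hxH
      have hφB : ∀ b ∈ B, φ b = 0 := by
        intro b hb
        by_cases h : ∃ i, f i b = 1
        · obtain ⟨i, hi⟩ := h
          have := hφH _ (hstar.add_mem i b hb hi)
          rwa [map_add, hφw, add_zero] at this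
        · push Not at h
          exact hφH b (hend b hb fun i => (zmod_two_cases _).resolve_right (h i))
      rw [hB.1 φ fun a ha b hb => by rw [hφB a ha, hφB b hb]] at hφx
      exact absurd hφx (by simp)
    · intro hx
      ext i
      exact hstar.map_sub i x hx
  have hsurj : Function.Surjective (LinearMap.pi f) := by
    intro c
    refine ⟨∑ k, c k • w k, ?_⟩
    ext i
    rw [LinearMap.pi_apply, map_sum, Finset.sum_eq_single i]
    · rw [map_smul, hstar.map_self, smul_eq_mul, mul_one]
    · intro k _ hk
      rw [map_smul, hstar.map_ne i k hk.symm, smul_zero]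
    · exact fun hi => absurd (Finset.mem_univ i) hi
  rw [natCard_eq_natCard_ker_mul _ hsurj, hker]
  simp

end Structure

/-! ### Breakpoints, densities and the numerical inequalities. -/

section Numerics

lemma breakpoint_eq (t : ℕ) : breakpoint t = ((t : ℝ) ^ 2 + t + 2) / (2 * (t + 1)) := by
  have h : (t : ℝ) + 1 ≠ 0 := by positivity
  rw [breakpoint, Nat.cast_choose_two]
  field_simp
  ring

lemma breakpoint_eq_add (t : ℕ) : breakpoint t = (t : ℝ) / 2 + 1 / (t + 1) := by
  have h : (t : ℝ) + 1 ≠ 0 := by positivity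
  rw [breakpoint_eq]
  field_simp

lemma breakpoint_lt_succ {t : ℕ} (ht : 1 ≤ t) : breakpoint t < breakpoint (t + 1) := by
  rw [breakpoint_eq_add, breakpoint_eq_add]
  have h1 : (1 : ℝ) ≤ t := by exact_mod_cast ht
  have h2 : (1 : ℝ) / (t + 1) ≤ 1 / 2 := one_div_le_one_div_of_le (by norm_num) (by linarith)
  have h3 : (0 : ℝ) < 1 / (((t + 1 : ℕ) : ℝ) + 1) := by positivity
  push_cast at h3 ⊢
  linarith

lemma breakpoint_mono {s t : ℕ} (hs : 1 ≤ s) (hst : s ≤ t) : breakpoint s ≤ breakpoint t := by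
  induction t, hst using Nat.le_induction with
  | base => exact le_rfl
  | succ t ht ih => exact ih.trans (breakpoint_lt_succ (hs.trans ht)).le

/-- The density of a Hamming ball of radius `2` in `ℤ₂ᵗ`. -/
noncomputable def ballDensity (t : ℕ) : ℝ := ((t : ℝ) ^ 2 + t + 2) / 2 ^ (t + 1)

/-- The density `(t² + t + 1) / 2 ^ (t + 1)`. -/
noncomputable def midDensity (t : ℕ) : ℝ := ((t : ℝ) ^ 2 + t + 1) / 2 ^ (t + 1)

lemma ballDensity_pos (t : ℕ) : 0 < ballDensity t := by
  unfold ballDensity; positivity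

lemma midDensity_pos (t : ℕ) : 0 < midDensity t := by
  unfold midDensity; positivity

lemma exists_ballDensity_le {c : ℝ} (hc : 0 < c) : ∃ t : ℕ, 1 ≤ t ∧ ballDensity t ≤ c := by
  have h := tendsto_pow_const_div_const_pow_of_one_lt 2 (r := (2 : ℝ)) (by norm_num)
  have h1 := h.eventually (gt_mem_nhds (show (0 : ℝ) < c / 2 by positivity))
  obtain ⟨t, ht, ht1⟩ := (h1.and (Filter.eventually_ge_atTop 1)).exists
  refine ⟨t, ht1, ?_⟩
  have ht1' : (1 : ℝ) ≤ t := by exact_mod_cast ht1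
  have h2 : (0 : ℝ) < 2 ^ t := by positivity
  rw [div_lt_iff₀ h2] at ht
  rw [ballDensity, div_le_iff₀ (by positivity), pow_succ (2 : ℝ) t]
  nlinarith

/-- A condition under which a set of normalised cardinality `α` and normalised
sumset cardinality `D`, in a group of normalised cardinality `2 ^ M`, obeys the bound on the
spanning constant. -/
def MeetsBound (M : ℕ) (D α : ℝ) : Prop :=
  ∃ t : ℕ, (1 ≤ t ∧ 2 ^ M * ballDensity t ≤ D ∧ breakpoint t * α ≤ D) ∨
    (2 ≤ t ∧ 2 ^ M * midDensity t ≤ D ∧ midBreakpoint t * α ≤ D)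

/-- At `j = 3` this fails once `M > 2`, which is why that value is treated separately where it is
applied. -/
lemma two_mul_le_two_pow_mul (M j : ℕ) (hj : 4 ≤ j) :
    2 * ((M : ℝ) + j - 1) * (j + 2) ≤ 2 ^ j * (M + 3) := by
  have hM : (0 : ℝ) ≤ M := Nat.cast_nonneg M
  induction j, hj using Nat.le_induction with
  | base => push_cast; nlinarith
  | succ j hj ih =>
    have hj' : (4 : ℝ) ≤ j := by exact_mod_cast hj
    rw [pow_succ]
    push_cast
    nlinarith

/-- The bound follows from the two crude estimates, except in one range of `D`. -/
lemma meetsBound_or_of_le {M : ℕ} (hM : 2 ≤ M) {D α : ℝ} (hα : 1 ≤ α)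
    (hαM : α ≤ ((M : ℝ) + 2) / 2) (hD : ((M : ℝ) + 3) / 2 + ((M : ℝ) - 1) / 2 * α ≤ D) :
    MeetsBound M D α ∨
      (D < ((M : ℝ) ^ 2 + 3 * M + 4) / 4 ∧ 2 ^ M * ballDensity (M + 2) ≤ D) := by
  classical
  have hM' : (2 : ℝ) ≤ M := by exact_mod_cast hM
  have hD0 : 0 < D := by nlinarith
  have hex : ∃ t : ℕ, 1 ≤ t ∧ 2 ^ M * ballDensity t ≤ D := by
    obtain ⟨t, ht, h⟩ := exists_ballDensity_le (c := D / 2 ^ M) (by positivity)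
    refine ⟨t, ht, ?_⟩
    rwa [le_div_iff₀' (by positivity)] at h
  -- Taking the least `t` gives an upper bound for `D` from the failure at `t - 1`, to be played
  -- against the lower bound `hD`.
  set t := Nat.find hex with htdef
  obtain ⟨ht1, htD⟩ : 1 ≤ t ∧ 2 ^ M * ballDensity t ≤ D := Nat.find_spec hex
  have hmin : ∀ s, 1 ≤ s → s < t → D < 2 ^ M * ballDensity s := by
    intro s hs hst
    have := Nat.find_min hex hst
    push Not at this
    exact this hs
  have h2M : (0 : ℝ) < 2 ^ M := by positivity
  rcases lt_or_ge t (M + 2) with h | h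
  · left
    refine ⟨t, Or.inl ⟨ht1, htD, ?_⟩⟩
    have h1 : breakpoint t ≤ breakpoint (M + 1) := breakpoint_mono ht1 (by omega)
    refine (mul_le_mul_of_nonneg_right h1 (by linarith)).trans (le_trans ?_ hD)
    rw [breakpoint_eq_add]
    push_cast
    have h2 : 1 / ((M : ℝ) + 1 + 1) * (M + 2) = 1 := by field_simp; ring
    have h3 : 0 < 1 / ((M : ℝ) + 1 + 1) := by positivity
    nlinarith
  rcases h.eq_or_lt with h | h
  · right
    refine ⟨?_, h ▸ htD⟩
    have := hmin (M + 1) (by omega) (by omega)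
    rw [ballDensity, mul_div_assoc', show (2 : ℝ) ^ (M + 1 + 1) = 2 ^ M * 4 by ring,
      mul_div_mul_left _ _ h2M.ne'] at this
    push_cast at this
    linarith
  · left
    refine ⟨t, Or.inl ⟨ht1, htD, ?_⟩⟩
    obtain ⟨j, hj⟩ : ∃ j, t = M + j := ⟨t - M, by omega⟩
    have hj3 : 3 ≤ j := by omega
    have hlt := hmin (t - 1) (by omega) (by omega)
    have hval : 2 ^ M * ballDensity (t - 1) = ((t : ℝ) ^ 2 - t + 2) / 2 ^ j := by
      rw [ballDensity, show t - 1 + 1 = M + j by omega, pow_add, mul_div_assoc',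
        mul_div_mul_left _ _ h2M.ne', Nat.cast_sub ht1]
      push_cast
      ring
    rw [hval, lt_div_iff₀ (by positivity)] at hlt
    have htj : (t : ℝ) = M + j := by rw [hj]; push_cast; ring
    have hj3' : (3 : ℝ) ≤ j := by exact_mod_cast hj3
    set e : ℝ := 1 / ((t : ℝ) + 1) with he
    have he0 : 0 < e := by positivity
    have hemul : e * (M + j + 1) = 1 := by rw [he, htj]; field_simp
    have hαle : ((M : ℝ) - 1) * α ≤ 2 * D - M - 3 := by linarith
    -- Combined with `hαle` this yields `α (j + 1 + 2e) ≤ M + 3`. Adding `(M - 1) α` turns the left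
    -- side into `2 α` times the breakpoint of `M + j`, and the right side is then at most `2 D`.
    have key : (2 * D - M - 3) * (j + 1 + 2 * e) ≤ (M + 3) * (M - 1) := by
      rcases hj3.eq_or_lt with hj3 | hj4
      · obtain rfl : j = 3 := hj3.symm
        rw [htj] at hlt
        push_cast at hlt hemul ⊢
        have h1 : 2 * D - M - 3 ≤ ((M : ℝ) ^ 2 + M - 4) / 4 := by nlinarith
        have h2 : (2 * D - M - 3) * (3 + 1 + 2 * e) ≤
            ((M : ℝ) ^ 2 + M - 4) / 4 * (3 + 1 + 2 * e) :=
          mul_le_mul_of_nonneg_right h1 (by linarith)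
        have h3 : e * ((M : ℝ) ^ 2 + M - 4) ≤ M + 1 := by nlinarith
        nlinarith
      · have hj4' : (4 : ℝ) ≤ j := by exact_mod_cast hj4
        have h1 := two_mul_le_two_pow_mul M j hj4
        have h2 : (t : ℝ) ^ 2 - t + 2 ≤ (t + 1) * (t - 1) := by nlinarith
        have h3 : 2 * (D * 2 ^ j) * (j + 2) ≤ 2 ^ j * ((M + 3) * (t + 1)) := by
          have h4 : 2 * (D * 2 ^ j) * (j + 2) ≤ 2 * ((t + 1) * (t - 1)) * ((j : ℝ) + 2) := by
            have := hlt.le.trans h2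
            nlinarith
          have h5 : (2 * ((M : ℝ) + j - 1) * (j + 2)) * (t + 1) ≤ (2 ^ j * (M + 3)) * (t + 1) :=
            mul_le_mul_of_nonneg_right h1 (by positivity)
          rw [← htj] at h5
          linarith
        have h4 : 2 * D * (j + 2) ≤ (M + 3) * (t + 1) := by
          have : (0 : ℝ) < 2 ^ j := by positivity
          refine le_of_mul_le_mul_left ?_ this
          linarith
        have h5 : e ≤ 1 / 2 := by
          rw [he]
          exact one_div_le_one_div_of_le (by norm_num) (by linarith)
        have h6 : 0 ≤ 2 * D - M - 3 := by nlinarith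
        have h7 : (2 * D - M - 3) * (j + 1 + 2 * e) ≤ (2 * D - M - 3) * (j + 2) :=
          mul_le_mul_of_nonneg_left (by linarith) h6
        rw [htj] at h4
        nlinarith
    have h8 : α * (j + 1 + 2 * e) ≤ M + 3 := by
      have hM1 : (0 : ℝ) < M - 1 := by linarith
      refine le_of_mul_le_mul_left ?_ hM1
      have := mul_le_mul_of_nonneg_right hαle (show (0 : ℝ) ≤ j + 1 + 2 * e by positivity)
      linarith
    rw [breakpoint_eq_add, ← he, htj]
    nlinarith

variable {ι : Type*} [DecidableEq ι]

lemma sum_sum_ite_add (S : Finset ι) (y : ι → ℝ) :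
    ∑ i ∈ S, ∑ k ∈ S, (if i = k then 0 else y i + y k) = 2 * ((S.card : ℝ) - 1) * ∑ i ∈ S, y i := by
  have h : ∀ i ∈ S, ∑ k ∈ S, (if i = k then 0 else y i + y k) =
      S.card * y i + ∑ k ∈ S, y k - 2 * y i := by
    intro i hi
    have h1 : ∀ k ∈ S, (if i = k then 0 else y i + y k) =
        (y i + y k) - (if i = k then 2 * y i else 0) := by
      intro k _
      split_ifs with h
      · subst h; ring
      · ring
    rw [Finset.sum_congr rfl h1, Finset.sum_sub_distrib, Finset.sum_add_distrib,
      Finset.sum_const, nsmul_eq_mul, Finset.sum_ite_eq S i, if_pos hi]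
  rw [Finset.sum_congr rfl h, Finset.sum_sub_distrib, Finset.sum_add_distrib, Finset.sum_const,
    nsmul_eq_mul, ← Finset.mul_sum, ← Finset.mul_sum]
  ring

lemma sum_sum_ite_const (S : Finset ι) (c : ℝ) :
    ∑ i ∈ S, ∑ k ∈ S, (if i = k then 0 else c) = (S.card : ℝ) * (S.card - 1) * c := by
  have := sum_sum_ite_add S (fun _ => c / 2)
  simp only [add_halves, Finset.sum_const, nsmul_eq_mul] at this
  rw [this]; ring

/-- Average the hypothesis over all pairs; a single index belongs to no pair and must be excluded.
-/
lemma sum_le_half_card {S : Finset ι} {y : ι → ℝ}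
    (hy : ∀ i ∈ S, ∀ k ∈ S, i ≠ k → y i + y k ≤ 1) (hS : S.card ≠ 1) :
    ∑ i ∈ S, y i ≤ (S.card : ℝ) / 2 := by
  rcases Nat.eq_zero_or_pos S.card with h0 | h0
  · rw [Finset.card_eq_zero.1 h0]; simp
  have h2 : (2 : ℝ) ≤ S.card := by exact_mod_cast (show 2 ≤ S.card by omega)
  have h3 : ∑ i ∈ S, ∑ k ∈ S, (if i = k then 0 else y i + y k) ≤
      ∑ i ∈ S, ∑ k ∈ S, (if i = k then 0 else (1 : ℝ)) := by
    refine Finset.sum_le_sum fun i hi => Finset.sum_le_sum fun k hk => ?_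
    split_ifs with h
    · exact le_rfl
    · exact hy i hi k hk h
  rw [sum_sum_ite_add, sum_sum_ite_const] at h3
  nlinarith

/-- A bound for the total loss `∑ ℓ` of a set whose fibres miss half of a subgroup by `η`. -/
lemma half_sum_loss_le {S : Finset ι} {η : ι → ℝ} {ℓ : ι → ι → ℝ} {κ : ℝ}
    (hη0 : ∀ i ∈ S, 0 ≤ η i) (hη1 : ∀ i ∈ S, η i ≤ 1 / 2) (hd : ∀ i, ℓ i i = 0)
    (hl : ∀ i ∈ S, ∀ k ∈ S, i ≠ k → ℓ i k ≤ η i) (hr : ∀ i ∈ S, ∀ k ∈ S, i ≠ k → ℓ i k ≤ η k)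
    (hz : ∀ i ∈ S, ∀ k ∈ S, i ≠ k → η i + η k < 1 / 2 → ℓ i k ≤ 0)
    (hq : ∀ i ∈ S, ∀ k ∈ S, i ≠ k → η i + η k < 3 / 4 → ℓ i k ≤ 1 / 4)
    (hκ3 : 3 ≤ κ) (hκ : ((S.card : ℝ) + 2) / 2 ≤ κ)
    (hT : 1 / 4 < (∑ i ∈ S, ∑ k ∈ S, ℓ i k) / 2) :
    (∑ i ∈ S, ∑ k ∈ S, ℓ i k) / 2 ≤ κ * (∑ i ∈ S, η i - 1 / 2) := by
  have hne : S.Nonempty := by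
    by_contra h
    rw [Finset.not_nonempty_iff_eq_empty.1 h] at hT
    simp at hT
    linarith
  -- Loss requires `η i + η k ≥ 1/2`. By maximality of `η a`, every lossy pair not containing `a`
  -- has both ends in `R`, so all loss lives on `insert a R`.
  obtain ⟨a, ha, hmax⟩ := Finset.exists_max_image S η hne
  set R := (S.erase a).filter (fun k => 1 / 2 ≤ η a + η k) with hR
  have hRS : ∀ k ∈ R, k ∈ S := fun k hk => Finset.mem_of_mem_erase (Finset.mem_filter.1 hk).1
  have hRa : ∀ k ∈ R, k ≠ a := fun k hk => Finset.ne_of_mem_erase (Finset.mem_filter.1 hk).1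
  have hRη : ∀ k ∈ R, 1 / 2 ≤ η a + η k := fun k hk => (Finset.mem_filter.1 hk).2
  have hmemR : ∀ k ∈ S, k ≠ a → 1 / 2 ≤ η a + η k → k ∈ R := fun k hk hka h =>
    Finset.mem_filter.2 ⟨Finset.mem_erase.2 ⟨hka, hk⟩, h⟩
  -- A bound for the loss at the pair of `a` and `k`. The cap `1/4` matters only when `R` has one
  -- element: there a loss above `1/4` forces `η a + η k ≥ 3/4`.
  set β : ι → ℝ := fun k => if η a + η k < 3 / 4 then min (η k) (1 / 4) else η k with hβ
  have hβη : ∀ k, β k ≤ η k := by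
    intro k
    simp only [hβ]
    split_ifs
    · exact min_le_left _ _
    · exact le_rfl
  have hβ0 : ∀ k ∈ S, 0 ≤ β k := by
    intro k hk
    simp only [hβ]
    split_ifs
    · exact le_min (hη0 k hk) (by norm_num)
    · exact hη0 k hk
  have hpt : ∀ i ∈ S, ∀ k ∈ S, ℓ i k ≤ (if i = a then (if k ∈ R then β k else 0) else 0) +
      (if k = a then (if i ∈ R then β i else 0) else 0) +
      (if i ∈ R then (if k ∈ R then (if i = k then 0 else η i / 2 + η k / 2) else 0) else 0) := by
    intro i hi k hk
    have t1 : 0 ≤ (if i = a then (if k ∈ R then β k else 0) else 0) := by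
      split_ifs
      · exact hβ0 k hk
      all_goals exact le_rfl
    have t2 : 0 ≤ (if k = a then (if i ∈ R then β i else 0) else 0) := by
      split_ifs
      · exact hβ0 i hi
      all_goals exact le_rfl
    have t3 : 0 ≤ (if i ∈ R then (if k ∈ R then (if i = k then 0 else η i / 2 + η k / 2)
        else 0) else 0) := by
      have := hη0 i hi
      have := hη0 k hk
      split_ifs
      any_goals exact le_rfl
      positivity
    by_cases hik : i = k
    · subst hik
      rw [hd]
      positivity
    rcases lt_or_ge (η i + η k) (1 / 2) with hlt | hge
    · exact (hz i hi k hk hik hlt).trans (by positivity)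
    by_cases hia : i = a
    · subst hia
      have hkR : k ∈ R := hmemR k hk (Ne.symm hik) hge
      have : ℓ i k ≤ β k := by
        simp only [hβ]
        split_ifs with h
        · exact le_min (hr i hi k hk hik) (hq i hi k hk hik h)
        · exact hr i hi k hk hik
      rw [if_pos rfl, if_pos hkR]
      linarith
    by_cases hka : k = a
    · subst hka
      have hiR : i ∈ R := hmemR i hi hik (by linarith)
      have : ℓ i k ≤ β i := by
        simp only [hβ]
        split_ifs with h
        · exact le_min (hl i hi k hk hik) (hq i hi k hk hik (by linarith))
        · exact hl i hi k hk hik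
      rw [if_pos (rfl : k = k), if_pos hiR]
      linarith
    have hiR : i ∈ R := hmemR i hi hia (by linarith [hmax k hk])
    have hkR : k ∈ R := hmemR k hk hka (by linarith [hmax i hi])
    simp only [if_pos hiR, if_pos hkR, if_neg hik, if_neg hia, if_neg hka]
    linarith [hl i hi k hk hik, hr i hi k hk hik]
  have hSR : S.filter (fun k => k ∈ R) = R := by
    ext k
    rw [Finset.mem_filter]
    exact ⟨fun h => h.2, fun h => ⟨hRS k h, h⟩⟩
  have hsum : ∀ g : ι → ℝ, ∑ k ∈ S, (if k ∈ R then g k else 0) = ∑ k ∈ R, g k := by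
    intro g
    rw [← Finset.sum_filter, hSR]
  have hTle : ∑ i ∈ S, ∑ k ∈ S, ℓ i k ≤
      2 * ∑ k ∈ R, β k + ((R.card : ℝ) - 1) * ∑ k ∈ R, η k := by
    refine (Finset.sum_le_sum fun i hi => Finset.sum_le_sum fun k hk => hpt i hi k hk).trans ?_
    simp only [Finset.sum_add_distrib]
    have s1 : ∑ i ∈ S, ∑ k ∈ S, (if i = a then (if k ∈ R then β k else 0) else 0) =
        ∑ k ∈ R, β k := by
      rw [Finset.sum_comm]
      simp only [Finset.sum_ite_eq', if_pos ha]
      exact hsum β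
    have s2 : ∑ i ∈ S, ∑ k ∈ S, (if k = a then (if i ∈ R then β i else 0) else 0) =
        ∑ k ∈ R, β k := by
      simp only [Finset.sum_ite_eq', if_pos ha]
      exact hsum β
    have s3 : ∑ i ∈ S, ∑ k ∈ S, (if i ∈ R then (if k ∈ R then
        (if i = k then 0 else η i / 2 + η k / 2) else 0) else 0) =
        ((R.card : ℝ) - 1) * ∑ k ∈ R, η k := by
      have : ∀ i ∈ S, ∑ k ∈ S, (if i ∈ R then (if k ∈ R then
          (if i = k then 0 else η i / 2 + η k / 2) else 0) else 0) =
          if i ∈ R then ∑ k ∈ R, (if i = k then 0 else η i / 2 + η k / 2) else 0 := by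
        intro i _
        split_ifs
        · exact hsum _
        · exact Finset.sum_const_zero
      rw [Finset.sum_congr rfl this, hsum, sum_sum_ite_add R (fun i => η i / 2), ← Finset.sum_div]
      ring
    rw [s1, s2, s3]
    linarith
  have hβsum : ∑ k ∈ R, β k ≤ ∑ k ∈ R, η k := Finset.sum_le_sum fun k _ => hβη k
  have hX0 : 0 ≤ ∑ k ∈ R, η k := Finset.sum_nonneg fun k hk => hη0 k (hRS k hk)
  have haR : a ∉ R := fun h => hRa a h rfl
  have hins : insert a R ⊆ S := Finset.insert_subset ha hRS
  have hsumS : η a + ∑ k ∈ R, η k ≤ ∑ i ∈ S, η i := by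
    rw [← Finset.sum_insert haR]
    exact Finset.sum_le_sum_of_subset_of_nonneg hins fun i hi _ => hη0 i hi
  have hcardS : R.card + 1 ≤ S.card := by
    rw [← Finset.card_insert_of_notMem haR]
    exact Finset.card_le_card hins
  have hcardS' : (R.card : ℝ) + 1 ≤ S.card := by exact_mod_cast hcardS
  rcases Nat.lt_or_ge R.card 2 with hlt | hge
  · interval_cases hc : R.card
    · rw [Finset.card_eq_zero.1 hc] at hTle
      simp at hTle
      linarith
    · obtain ⟨k, hk⟩ := Finset.card_eq_one.1 hc
      have hkR : k ∈ R := hk ▸ Finset.mem_singleton_self k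
      rw [hk] at hTle hsumS
      simp only [Finset.sum_singleton, Nat.cast_one, sub_self, zero_mul, add_zero] at hTle hsumS
      have h1 : 3 / 4 ≤ η a + η k := by
        by_contra hcon
        push Not at hcon
        have : β k ≤ 1 / 4 := by
          simp only [hβ, if_pos hcon]
          exact min_le_right _ _
        linarith
      have h2 := hη1 k (hRS k hkR)
      have h3 := hβη k
      nlinarith
  · have hn2 : (2 : ℝ) ≤ R.card := by exact_mod_cast hge
    set n : ℝ := (R.card : ℝ) with hn
    set X := ∑ k ∈ R, η k with hX
    -- Every `k ∈ R` satisfies `η k ≥ 1/2 - η a`; summing ties `X` to the excess of the total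
    -- deficiency over `1/2`.
    have h1 : n * (1 / 2 - η a) ≤ X := by
      rw [hn, ← nsmul_eq_mul, ← Finset.sum_const]
      exact Finset.sum_le_sum fun k hk => by linarith [hRη k hk]
    have h2 : (n - 1) * X ≤ n * (∑ i ∈ S, η i - 1 / 2) := by nlinarith
    -- At `n = 2` this is exactly `κ ≥ 3`; from `n = 3` on, `κ ≥ (n + 3) / 2` suffices.
    have h3 : n * (n + 1) ≤ 2 * κ * (n - 1) := by
      rcases hge.eq_or_lt with h | h
      · have : n = 2 := by rw [hn, ← h]; norm_num
        rw [this]; linarith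
      · have : (3 : ℝ) ≤ n := by rw [hn]; exact_mod_cast h
        nlinarith
    have h4 : (∑ i ∈ S, ∑ k ∈ S, ℓ i k) / 2 ≤ (n + 1) / 2 * X := by nlinarith
    refine h4.trans ?_
    have hnpos : 0 < n := by linarith
    refine le_of_mul_le_mul_left ?_ hnpos
    have h5 : n * (n + 1) * X ≤ 2 * κ * (n - 1) * X := mul_le_mul_of_nonneg_right h3 hX0
    have h6 : κ * ((n - 1) * X) ≤ κ * (n * (∑ i ∈ S, η i - 1 / 2)) :=
      mul_le_mul_of_nonneg_left h2 (by linarith)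
    linarith

end Numerics

/-! ### The numerical bound for normalised stars. -/

section StarProfile

variable {ι : Type*}

/-- The normalised cardinalities `y` of the arms of a star and lower bounds `h` for the cardinalities
of their pairwise sums. -/
structure IsStarProfile (y : ι → ℝ) (h : ι → ι → ℝ) : Prop where
  diag : ∀ i, h i i = 0
  symm : ∀ i k, h i k = h k i
  pos : ∀ i, 0 < y i
  pair : ∀ i k, i ≠ k → y i + y k ≤ 1
  le : ∀ i k, i ≠ k → y i ≤ h i k
  half : ∀ i k, i ≠ k → 1 / 2 < y i + y k → 1 / 2 ≤ h i k
  quarter : ∀ i k, i ≠ k → 1 / 4 < y i + y k → 1 / 4 ≤ h i k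
  big : ∀ i k, i ≠ k → 1 / 2 < y i → y k ≤ 1 / 2 → 1 / 2 + y k ≤ h i k

namespace IsStarProfile

variable {y : ι → ℝ} {h : ι → ι → ℝ}

lemma le_right (hp : IsStarProfile y h) {i k : ι} (hik : i ≠ k) : y k ≤ h i k :=
  hp.symm i k ▸ hp.le k i hik.symm

variable [Fintype ι]

lemma exists_univ_eq_of_card_eq_three (hc : Fintype.card ι = 3) {a b : ι} (hab : a ≠ b) :
    ∃ c, a ≠ c ∧ b ≠ c ∧ ∀ g : ι → ℝ, ∑ i, g i = g a + g b + g c := by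
  classical
  have h1 : ((Finset.univ.erase a).erase b).card = 1 := by
    rw [Finset.card_erase_of_mem (Finset.mem_erase.2 ⟨hab.symm, Finset.mem_univ b⟩),
      Finset.card_erase_of_mem (Finset.mem_univ a), Finset.card_univ, hc]
  obtain ⟨c, hcc⟩ := Finset.card_eq_one.1 h1
  have hc' : c ∈ (Finset.univ.erase a).erase b := hcc ▸ Finset.mem_singleton_self c
  rw [Finset.mem_erase, Finset.mem_erase] at hc'
  refine ⟨c, hc'.2.1.symm, hc'.1.symm, fun g => ?_⟩
  rw [← Finset.add_sum_erase _ g (Finset.mem_univ a),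
    ← Finset.add_sum_erase _ g (Finset.mem_erase.2 ⟨hab.symm, Finset.mem_univ b⟩), hcc,
    Finset.sum_singleton, add_assoc]

lemma exists_three (hp : IsStarProfile y h) (hc : Fintype.card ι = 3) {a b : ι} (hab : a ≠ b) :
    ∃ c, a ≠ c ∧ b ≠ c ∧ ∑ i, y i = y a + y b + y c ∧
      (∑ i, ∑ k, h i k) / 2 = h a b + h a c + h b c := by
  obtain ⟨c, hac, hbc, hs⟩ := exists_univ_eq_of_card_eq_three hc hab
  refine ⟨c, hac, hbc, hs y, ?_⟩
  simp only [hs, hp.diag]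
  rw [hp.symm b a, hp.symm c a, hp.symm c b]
  ring

variable [DecidableEq ι]

/-- Each `h i k` is at least the average of `y i` and `y k`. -/
lemma crude_le (hp : IsStarProfile y h) :
    ((Fintype.card ι : ℝ) + 3) / 2 + ((Fintype.card ι : ℝ) - 1) / 2 * (1 + ∑ i, y i) ≤
      1 + Fintype.card ι + (∑ i, ∑ k, h i k) / 2 := by
  have h1 : ∑ i, ∑ k, (if i = k then 0 else y i / 2 + y k / 2) ≤ ∑ i, ∑ k, h i k := by
    refine Finset.sum_le_sum fun i _ => Finset.sum_le_sum fun k _ => ?_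
    split_ifs with hik
    · rw [hik, hp.diag]
    · linarith [hp.le i k hik, hp.le_right hik]
  rw [sum_sum_ite_add Finset.univ (fun i => y i / 2), ← Finset.sum_div, Finset.card_univ] at h1
  linarith

/-- If every pair exceeded `1/2`, every `h i k` would be at least `1/2` and `D` would reach `2 ^ M
ballDensity (M + 1)`. -/
lemma exists_pair (hp : IsStarProfile y h)
    (hD : 1 + Fintype.card ι + (∑ i, ∑ k, h i k) / 2 <
      ((Fintype.card ι : ℝ) ^ 2 + 3 * Fintype.card ι + 4) / 4) :
    ∃ a b, a ≠ b ∧ y a + y b ≤ 1 / 2 := by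
  by_contra hno
  push Not at hno
  have h1 : ∑ i : ι, ∑ k : ι, (if i = k then 0 else (1 / 2 : ℝ)) ≤ ∑ i, ∑ k, h i k := by
    refine Finset.sum_le_sum fun i _ => Finset.sum_le_sum fun k _ => ?_
    split_ifs with hik
    · rw [hik, hp.diag]
    · exact hp.half i k hik (hno i k hik)
  rw [sum_sum_ite_const, Finset.card_univ] at h1
  linarith

/-- Two arms total at most `1/2`, and the remaining `M - 2` average at most `1/2` unless there is
exactly one of them. That case, `M = 3`, uses the stronger sumset bound `big`. -/
lemma sum_le_of_lt (hp : IsStarProfile y h) (hM : 2 ≤ Fintype.card ι)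
    (hD : 1 + Fintype.card ι + (∑ i, ∑ k, h i k) / 2 <
      ((Fintype.card ι : ℝ) ^ 2 + 3 * Fintype.card ι + 4) / 4) :
    1 + ∑ i, y i ≤ ((Fintype.card ι : ℝ) + 1) / 2 := by
  obtain ⟨a, b, hab, hy⟩ := hp.exists_pair hD
  by_cases h3 : Fintype.card ι = 3
  · obtain ⟨c, hac, hbc, hs, hT⟩ := hp.exists_three h3 hab
    rw [hT, h3] at hD
    rw [hs, h3]
    push_cast at hD ⊢
    by_contra hcon
    push Not at hcon
    have pa := hp.pos a
    have pb := hp.pos b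
    have c1 : 1 / 2 < y c := by linarith
    have c2 := hp.big c a hac.symm c1 (by linarith)
    have c3 := hp.big c b hbc.symm c1 (by linarith)
    rw [hp.symm] at c2 c3
    have c4 := hp.le a b hab
    have c5 := hp.le_right hab
    have c6 := hp.le_right hac
    have c7 := hp.le_right hbc
    linarith
  · have hb : b ∈ Finset.univ.erase a := Finset.mem_erase.2 ⟨hab.symm, Finset.mem_univ b⟩
    have hcard : ((Finset.univ.erase a).erase b).card = Fintype.card ι - 2 := by
      rw [Finset.card_erase_of_mem hb, Finset.card_erase_of_mem (Finset.mem_univ a),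
        Finset.card_univ]
      omega
    have h1 := sum_le_half_card (S := (Finset.univ.erase a).erase b) (y := y)
      (fun i _ k _ hik => hp.pair i k hik) (by omega)
    rw [hcard, Nat.cast_sub hM] at h1
    rw [← Finset.add_sum_erase _ y (Finset.mem_univ a), ← Finset.add_sum_erase _ y hb]
    push_cast at h1
    linarith

/-- The breakpoint of `M + 2` is `κ = (M + 2) / 2 + 1 / (M + 3)`, which meets the requirement `κ ≥
3` of `half_sum_loss_le` because `M ≥ 4`. -/
lemma mul_le_of_lt_of_four_le_of_forall_le (hp : IsStarProfile y h) (hM : 4 ≤ Fintype.card ι)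
    (hy : ∀ i, y i ≤ 1 / 2)
    (hD : 1 + Fintype.card ι + (∑ i, ∑ k, h i k) / 2 <
      ((Fintype.card ι : ℝ) ^ 2 + 3 * Fintype.card ι + 3) / 4) :
    breakpoint (Fintype.card ι + 2) * (1 + ∑ i, y i) ≤
      1 + Fintype.card ι + (∑ i, ∑ k, h i k) / 2 := by
  have hM' : (4 : ℝ) ≤ Fintype.card ι := by exact_mod_cast hM
  rw [breakpoint_eq_add]
  push_cast
  set M : ℝ := (Fintype.card ι : ℝ) with hMdef
  set e : ℝ := 1 / (M + 2 + 1) with he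
  have he0 : 0 < e := by positivity
  have heM : e * (M + 3) = 1 := by rw [he]; field_simp; ring
  have hTeq : ∑ i, ∑ k, (if i = k then 0 else 1 / 2 - h i k) =
      M * (M - 1) * (1 / 2) - ∑ i, ∑ k, h i k := by
    rw [hMdef, ← Finset.card_univ, ← sum_sum_ite_const, ← Finset.sum_sub_distrib]
    refine Finset.sum_congr rfl fun i _ => ?_
    rw [← Finset.sum_sub_distrib]
    refine Finset.sum_congr rfl fun k _ => ?_
    split_ifs with hik
    · rw [hik, hp.diag, sub_zero]
    · rfl
  have hη : ∑ i, (1 / 2 - y i) = M / 2 - ∑ i, y i := by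
    rw [Finset.sum_sub_distrib, Finset.sum_const, Finset.card_univ, nsmul_eq_mul]
    ring
  -- With total loss `T`, `D = (M² + 3M + 4) / 4 - T`, so `hD` says precisely `T > 1/4`.
  have key := half_sum_loss_le (S := Finset.univ) (η := fun i => 1 / 2 - y i)
    (ℓ := fun i k => if i = k then 0 else 1 / 2 - h i k) (κ := (M + 2) / 2 + e)
    (fun i _ => by linarith [hy i]) (fun i _ => by linarith [hp.pos i]) (fun i => if_pos rfl)
    (fun i _ k _ hik => by rw [if_neg hik]; linarith [hp.le i k hik])
    (fun i _ k _ hik => by rw [if_neg hik]; linarith [hp.le_right hik])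
    (fun i _ k _ hik hlt => by rw [if_neg hik]; linarith [hp.half i k hik (by linarith)])
    (fun i _ k _ hik hlt => by rw [if_neg hik]; linarith [hp.quarter i k hik (by linarith)])
    (by linarith) (by rw [Finset.card_univ]; linarith)
    (by rw [hTeq]; nlinarith)
  rw [hTeq, hη] at key
  nlinarith

/-- All arms other than `z` are at most `1/2`, so the loss estimate is applied to them alone. -/
lemma mul_le_of_lt_of_four_le_of_lt (hp : IsStarProfile y h) (hM : 4 ≤ Fintype.card ι)
    {z : ι} (hz : 1 / 2 < y z)
    (hD : 1 + Fintype.card ι + (∑ i, ∑ k, h i k) / 2 <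
      ((Fintype.card ι : ℝ) ^ 2 + 3 * Fintype.card ι + 3) / 4) :
    breakpoint (Fintype.card ι + 2) * (1 + ∑ i, y i) ≤
      1 + Fintype.card ι + (∑ i, ∑ k, h i k) / 2 := by
  have hM' : (4 : ℝ) ≤ Fintype.card ι := by exact_mod_cast hM
  set S := Finset.univ.erase z with hS
  have hcard : (S.card : ℝ) = (Fintype.card ι : ℝ) - 1 := by
    rw [hS, Finset.card_erase_of_mem (Finset.mem_univ z), Finset.card_univ,
      Nat.cast_sub (by omega), Nat.cast_one]
  rw [breakpoint_eq_add]
  push_cast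
  set M : ℝ := (Fintype.card ι : ℝ) with hMdef
  set e : ℝ := 1 / (M + 2 + 1) with he
  have he0 : 0 < e := by positivity
  have heM : e * (M + 3) = 1 := by rw [he]; field_simp; ring
  have hSz : ∀ i ∈ S, i ≠ z := fun i hi => Finset.ne_of_mem_erase hi
  have hsplit : ∑ i, ∑ k, h i k = ∑ i ∈ S, ∑ k ∈ S, h i k + 2 * ∑ k ∈ S, h z k := by
    rw [← Finset.add_sum_erase _ _ (Finset.mem_univ z), ← hS]
    have h1 : ∀ i ∈ S, ∑ k, h i k = h z i + ∑ k ∈ S, h i k := by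
      intro i _
      rw [← Finset.add_sum_erase _ _ (Finset.mem_univ z), ← hS, hp.symm]
    rw [Finset.sum_congr rfl h1, Finset.sum_add_distrib,
      ← Finset.add_sum_erase _ _ (Finset.mem_univ z), ← hS, hp.diag]
    ring
  have hz' : (M - 1) * y z ≤ ∑ k ∈ S, h z k := by
    rw [← hcard, ← nsmul_eq_mul, ← Finset.sum_const]
    exact Finset.sum_le_sum fun k hk => hp.le z k (hSz k hk).symm
  have hTeq : ∑ i ∈ S, ∑ k ∈ S, (if i = k then 0 else 1 / 2 - h i k) =
      (M - 1) * (M - 2) * (1 / 2) - ∑ i ∈ S, ∑ k ∈ S, h i k := by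
    rw [show (M - 1) * (M - 2) * (1 / 2) = (S.card : ℝ) * (S.card - 1) * (1 / 2) by rw [hcard]; ring,
      ← sum_sum_ite_const, ← Finset.sum_sub_distrib]
    refine Finset.sum_congr rfl fun i _ => ?_
    rw [← Finset.sum_sub_distrib]
    refine Finset.sum_congr rfl fun k _ => ?_
    split_ifs with hik
    · rw [hik, hp.diag, sub_zero]
    · rfl
  have hη : ∑ i ∈ S, (1 / 2 - y i) = (M - 1) / 2 - ∑ i ∈ S, y i := by
    rw [Finset.sum_sub_distrib, Finset.sum_const, nsmul_eq_mul, hcard]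
    ring
  have hyS : ∀ i ∈ S, y i ≤ 1 / 2 := fun i hi => by linarith [hp.pair i z (hSz i hi)]
  have hz1 : y z ≤ 1 := by
    have : 1 < Fintype.card ι := by omega
    obtain ⟨b, hb⟩ := Fintype.exists_ne_of_one_lt_card this z
    linarith [hp.pair b z hb, hp.pos b]
  rw [hsplit] at hD ⊢
  have key := half_sum_loss_le (S := S) (η := fun i => 1 / 2 - y i)
    (ℓ := fun i k => if i = k then 0 else 1 / 2 - h i k) (κ := (M + 2) / 2 + e)
    (fun i hi => by linarith [hyS i hi]) (fun i _ => by linarith [hp.pos i]) (fun i => if_pos rfl)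
    (fun i _ k _ hik => by rw [if_neg hik]; linarith [hp.le i k hik])
    (fun i _ k _ hik => by rw [if_neg hik]; linarith [hp.le_right hik])
    (fun i _ k _ hik hlt => by rw [if_neg hik]; linarith [hp.half i k hik (by linarith)])
    (fun i _ k _ hik hlt => by rw [if_neg hik]; linarith [hp.quarter i k hik (by linarith)])
    (by linarith) (by rw [hcard]; linarith)
    (by rw [hTeq]; nlinarith)
  rw [hTeq, hη] at key
  rw [← Finset.add_sum_erase _ y (Finset.mem_univ z), ← hS]
  set Y := ∑ i ∈ S, y i
  obtain ⟨v, hv⟩ : ∃ v, y z = 1 / 2 + v := ⟨y z - 1 / 2, by ring⟩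
  have hv1 : v ≤ 1 / 2 := by linarith
  rw [hv] at hz' ⊢
  -- The excess `v` of the large arm gains `(M - 1) v` in pair sums and costs `((M + 2) / 2 + e) v`;
  -- the balance is `(M / 2 - 2) v - e v`.
  have h1 : 0 ≤ (M / 2 - 2) * v := mul_nonneg (by linarith) (by linarith)
  have h2 : e * v ≤ e * (1 / 2) := mul_le_mul_of_nonneg_left hv1 he0.le
  nlinarith

/-- The breakpoint is `8/3 < 3`, out of reach of `half_sum_loss_le`, so the positions of the three
pairs relative to `1/2` are examined directly. -/
lemma mul_le_of_lt_of_card_eq_three (hp : IsStarProfile y h) (hM : Fintype.card ι = 3)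
    (hD : 1 + Fintype.card ι + (∑ i, ∑ k, h i k) / 2 <
      ((Fintype.card ι : ℝ) ^ 2 + 3 * Fintype.card ι + 3) / 4) :
    breakpoint (Fintype.card ι + 2) * (1 + ∑ i, y i) ≤
      1 + Fintype.card ι + (∑ i, ∑ k, h i k) / 2 := by
  obtain ⟨a, b, hab, hy⟩ := hp.exists_pair (hD.trans (by linarith))
  obtain ⟨c, hac, hbc, hs, hT⟩ := hp.exists_three hM hab
  rw [hT, hM] at hD
  rw [hs, hT, hM, breakpoint_eq]
  norm_num at hD ⊢
  have pa := hp.pos a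
  have pb := hp.pos b
  have pc := hp.pos c
  have l1 := hp.le a b hab
  have l2 := hp.le_right hab
  have l3 := hp.le a c hac
  have l4 := hp.le_right hac
  have l5 := hp.le b c hbc
  have l6 := hp.le_right hbc
  have q1 := hp.pair a c hac
  have q2 := hp.pair b c hbc
  have single : ∀ u v w huv : ℝ, 0 < u → 0 < v → w ≤ 1 / 2 → u ≤ huv → v ≤ huv →
      (1 / 4 < u + v → 1 / 4 ≤ huv) → huv < 1 / 4 →
      8 / 3 * (1 + (u + v + w)) ≤ 4 + (huv + 1) := by
    intro u v w huv hu hv hw h1 h2 h3 h4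
    have : u + v ≤ 1 / 4 := by
      by_contra hcon
      push Not at hcon
      linarith [h3 hcon]
    linarith
  rcases lt_or_ge (1 / 2) (y c) with hc | hc
  · have c1 : h a b < 1 / 4 := by linarith
    have c2 : y a + y b ≤ 1 / 4 := by
      by_contra hcon
      push Not at hcon
      linarith [hp.quarter a b hab hcon]
    linarith
  · have two : ∀ u v w huv huw hvw : ℝ, 0 < u → 0 < v → 0 < w → v ≤ 1 / 2 → w ≤ 1 / 2 →
        u + v ≤ 1 / 2 → u + w ≤ 1 / 2 → v ≤ huv → w ≤ huw → 1 / 2 ≤ hvw →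
        8 / 3 * (1 + (u + v + w)) ≤ 4 + (huv + huw + hvw) := by
      intro u v w huv huw hvw _ _ _ _ _ _ _ _ _ _
      linarith
    have one : ∀ u v w huv huw hvw : ℝ, 0 < u → 0 < v → w ≤ 1 / 2 → u ≤ huv → v ≤ huv →
        (1 / 4 < u + v → 1 / 4 ≤ huv) → 4 + (huv + huw + hvw) < 21 / 4 → 1 / 2 ≤ huw →
        1 / 2 ≤ hvw → 8 / 3 * (1 + (u + v + w)) ≤ 4 + (huv + huw + hvw) := by
      intro u v w huv huw hvw h1 h2 h3 h4 h5 h6 h7 h8 h9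
      linarith [single u v w huv h1 h2 h3 h4 h5 h6 (by linarith)]
    rcases le_or_gt (y a + y c) (1 / 2) with hac' | hac'
    · rcases le_or_gt (y b + y c) (1 / 2) with hbc' | hbc'
      · rcases le_total (y a) (y b) with o1 | o1 <;> rcases le_total (y a) (y c) with o2 | o2 <;>
          rcases le_total (y b) (y c) with o3 | o3 <;> linarith
      · have := two (y a) (y b) (y c) (h a b) (h a c) (h b c) pa pb pc (by linarith) hc hy hac' l2 l4
          (hp.half b c hbc hbc')
        linarith
    · rcases le_or_gt (y b + y c) (1 / 2) with hbc' | hbc'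
      · have := two (y b) (y a) (y c) (h a b) (h b c) (h a c) pb pa pc (by linarith) hc
          (by linarith) hbc' l1 l6 (hp.half a c hac hac')
        linarith
      · have := one (y a) (y b) (y c) (h a b) (h a c) (h b c) pa pb hc l1 l2 (hp.quarter a b hab)
          (by linarith) (hp.half a c hac hac') (hp.half b c hbc hbc')
        linarith

lemma mul_le_of_lt_of_card_eq_two (hp : IsStarProfile y h) (hM : Fintype.card ι = 2)
    (hD : 1 + Fintype.card ι + (∑ i, ∑ k, h i k) / 2 <
      ((Fintype.card ι : ℝ) ^ 2 + 3 * Fintype.card ι + 3) / 4) :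
    breakpoint (Fintype.card ι + 2) * (1 + ∑ i, y i) ≤
      1 + Fintype.card ι + (∑ i, ∑ k, h i k) / 2 := by
  obtain ⟨a, b, hab, hy⟩ := hp.exists_pair (hD.trans (by linarith))
  have huniv : (Finset.univ : Finset ι) = {a, b} :=
    (Finset.eq_univ_of_card _ (by rw [Finset.card_pair hab, hM])).symm
  have hs : ∀ g : ι → ℝ, ∑ i, g i = g a + g b := fun g => by rw [huniv, Finset.sum_pair hab]
  simp only [hs, hp.diag, hp.symm b a] at hD ⊢
  rw [hM] at hD
  rw [hM, breakpoint_eq]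
  norm_num at hD ⊢
  have l1 := hp.le a b hab
  have l2 := hp.le_right hab
  have : y a + y b ≤ 1 / 4 := by
    by_contra hcon
    push Not at hcon
    linarith [hp.quarter a b hab hcon]
  linarith

lemma mul_le_of_lt (hp : IsStarProfile y h) (hM : 2 ≤ Fintype.card ι)
    (hD : 1 + Fintype.card ι + (∑ i, ∑ k, h i k) / 2 <
      ((Fintype.card ι : ℝ) ^ 2 + 3 * Fintype.card ι + 3) / 4) :
    breakpoint (Fintype.card ι + 2) * (1 + ∑ i, y i) ≤
      1 + Fintype.card ι + (∑ i, ∑ k, h i k) / 2 := by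
  rcases hM.eq_or_lt with h2 | h2
  · exact hp.mul_le_of_lt_of_card_eq_two h2.symm hD
  rcases (show 3 ≤ Fintype.card ι from h2).eq_or_lt with h3 | h3
  · exact hp.mul_le_of_lt_of_card_eq_three h3.symm hD
  by_cases hy : ∃ z, 1 / 2 < y z
  · obtain ⟨z, hz⟩ := hy
    exact hp.mul_le_of_lt_of_four_le_of_lt h3 hz hD
  · push Not at hy
    exact hp.mul_le_of_lt_of_four_le_of_forall_le h3 hy hD

theorem meetsBound (hp : IsStarProfile y h) (hM : 2 ≤ Fintype.card ι) :
    MeetsBound (Fintype.card ι) (1 + Fintype.card ι + (∑ i, ∑ k, h i k) / 2) (1 + ∑ i, y i) := by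
  have hα : 1 ≤ 1 + ∑ i, y i := by
    linarith [Finset.sum_nonneg fun i (_ : i ∈ Finset.univ) => (hp.pos i).le]
  have hαM := sum_le_half_card (S := Finset.univ) (y := y) (fun i _ k _ hik => hp.pair i k hik)
    (by rw [Finset.card_univ]; omega)
  rw [Finset.card_univ] at hαM
  rcases meetsBound_or_of_le hM hα (by linarith) hp.crude_le with h1 | ⟨hD, hb⟩
  · exact h1
  rcases lt_or_ge (1 + Fintype.card ι + (∑ i, ∑ k, h i k) / 2)
    (((Fintype.card ι : ℝ) ^ 2 + 3 * Fintype.card ι + 3) / 4) with hlt | hge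
  · exact ⟨Fintype.card ι + 2, Or.inl ⟨by omega, hb, hp.mul_le_of_lt hM hlt⟩⟩
  · refine ⟨Fintype.card ι + 1, Or.inr ⟨by omega, ?_, ?_⟩⟩
    · rw [midDensity, mul_div_assoc',
        show (2 : ℝ) ^ (Fintype.card ι + 1 + 1) = 2 ^ Fintype.card ι * 4 by ring,
        mul_div_mul_left _ _ (by positivity)]
      push_cast
      linarith
    -- With `α ≤ (M + 1) / 2`, the middle breakpoint of `M + 1` times that cap equals `(M² + 3M + 3)
    -- / 4`.
    · refine le_trans ?_ hge
      have h1 := hp.sum_le_of_lt hM hD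
      refine (mul_le_mul_of_nonneg_left h1 (by unfold midBreakpoint; positivity)).trans ?_
      rw [midBreakpoint]
      push_cast
      apply le_of_eq
      field_simp
      ring

end IsStarProfile

end StarProfile

/-! ### From stars to normalised profiles. -/

section StarSumset

lemma sum_small_le_sum {M : ℕ} {c : Finset (Fin M) → ℝ} (hc : ∀ s, 0 ≤ c s) :
    c ∅ + ∑ i, c {i} + (∑ i, ∑ k, if i = k then 0 else c {i, k}) / 2 ≤ ∑ s, c s := by
  set T : Finset (Fin M × Fin M) := Finset.univ.filter (fun p => p.1 < p.2) with hT
  have hpairs : (∑ i, ∑ k, if i = k then 0 else c {i, k}) / 2 = ∑ p ∈ T, c {p.1, p.2} := by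
    have h1 : ∀ i k : Fin M, (if i = k then 0 else c {i, k}) =
        (if i < k then c {i, k} else 0) + (if k < i then c {k, i} else 0) := by
      intro i k
      rcases lt_trichotomy i k with h | h | h
      · rw [if_neg h.ne, if_pos h, if_neg h.not_gt, add_zero]
      · rw [if_pos h, if_neg h.not_lt, if_neg h.symm.not_lt, add_zero]
      · rw [if_neg h.ne', if_neg h.not_gt, if_pos h, zero_add, Finset.pair_comm]
    have h2 : ∑ p ∈ T, c {p.1, p.2} = ∑ i, ∑ k, if i < k then c {i, k} else 0 := by
      rw [hT, Finset.sum_filter, Fintype.sum_prod_type]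
    simp only [h1, Finset.sum_add_distrib]
    rw [h2, Finset.sum_comm (f := fun i k => if k < i then c {k, i} else 0)]
    ring
  have hinj2 : Set.InjOn (fun p : Fin M × Fin M => ({p.1, p.2} : Finset (Fin M))) T := by
    rintro ⟨i, k⟩ hp ⟨i', k'⟩ hp' heq
    simp only [hT, Finset.coe_filter, Finset.mem_univ, true_and, Set.mem_ofPred_eq] at hp hp'
    have heq : ({i, k} : Finset (Fin M)) = {i', k'} := heq
    have m1 : i ∈ ({i', k'} : Finset (Fin M)) := heq ▸ Finset.mem_insert_self i {k}
    have m2 : k ∈ ({i', k'} : Finset (Fin M)) :=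
      heq ▸ Finset.mem_insert_of_mem (Finset.mem_singleton_self k)
    simp only [Finset.mem_insert, Finset.mem_singleton] at m1 m2
    rcases m1 with rfl | rfl <;> rcases m2 with rfl | rfl
    · exact absurd hp (lt_irrefl _)
    · rfl
    · exact absurd hp hp'.not_gt
    · exact absurd hp (lt_irrefl _)
  have hinj1 : Set.InjOn (fun i : Fin M => ({i} : Finset (Fin M))) (Finset.univ : Finset (Fin M)) :=
    fun i _ k _ h => Finset.singleton_injective h
  set S1 := (Finset.univ : Finset (Fin M)).image (fun i => ({i} : Finset (Fin M))) with hS1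
  set S2 := T.image (fun p => ({p.1, p.2} : Finset (Fin M))) with hS2
  have e1 : ∑ i, c {i} = ∑ s ∈ S1, c s := (Finset.sum_image hinj1).symm
  have e2 : ∑ p ∈ T, c {p.1, p.2} = ∑ s ∈ S2, c s := (Finset.sum_image hinj2).symm
  have c1 : ∀ s ∈ S1, s.card = 1 := by
    intro s hs
    obtain ⟨i, -, rfl⟩ := Finset.mem_image.1 hs
    exact Finset.card_singleton i
  have c2 : ∀ s ∈ S2, s.card = 2 := by
    intro s hs
    obtain ⟨p, hp, rfl⟩ := Finset.mem_image.1 hs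
    exact Finset.card_pair (Finset.mem_filter.1 hp).2.ne
  have d0 : ∅ ∉ S1 := fun h => by simpa using c1 _ h
  have d12 : Disjoint (insert ∅ S1) S2 := by
    rw [Finset.disjoint_left]
    intro s hs hs2
    have h2 := c2 s hs2
    rcases Finset.mem_insert.1 hs with rfl | hs
    · simp at h2
    · rw [c1 s hs] at h2; omega
  rw [hpairs, e1, e2, ← Finset.sum_insert d0, ← Finset.sum_union d12]
  exact Finset.sum_le_sum_of_subset_of_nonneg (Finset.subset_univ _) fun s _ _ => hc s

variable {V : Type*} [AddCommGroup V] [Module (ZMod 2) V] [DecidableEq V]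

/-- The part of `A` in the coset `w i + H`, shifted into `H`. -/
def starArm (A : Finset V) {M : ℕ} (w : Fin M → V) (f : Fin M → V →ₗ[ZMod 2] ZMod 2) (i : Fin M) :
    Finset V :=
  (A.filter (fun x => f i x = 1)).image (fun x => x + w i)

lemma card_starArm (A : Finset V) {M : ℕ} (w : Fin M → V) (f : Fin M → V →ₗ[ZMod 2] ZMod 2)
    (i : Fin M) : (starArm A w f i).card = (A.filter (fun x => f i x = 1)).card :=
  Finset.card_image_of_injective _ (add_left_injective (w i))

namespace IsPartialStar

variable {H : Submodule (ZMod 2) V} {A : Finset V} {M : ℕ} {w : Fin M → V}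
  {f : Fin M → V →ₗ[ZMod 2] ZMod 2}

lemma starArm_subset (hs : IsPartialStar H A w f) (i : Fin M) : ∀ x ∈ starArm A w f i, x ∈ H := by
  intro x hx
  obtain ⟨y, hy, rfl⟩ := Finset.mem_image.1 hx
  rw [Finset.mem_filter] at hy
  exact hs.add_mem i y hy.1 hy.2

lemma starArm_nonempty (hs : IsPartialStar H A w f) (i : Fin M) : (starArm A w f i).Nonempty :=
  ⟨_, Finset.mem_image_of_mem _ (Finset.mem_filter.2 ⟨hs.mem i, hs.map_self i⟩)⟩

lemma add_mem_of_mem_starArm {i : Fin M} {x : V} (hx : x ∈ starArm A w f i) : x + w i ∈ A := by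
  obtain ⟨y, hy, rfl⟩ := Finset.mem_image.1 hx
  rw [add_add_cancel_two]
  exact (Finset.mem_filter.1 hy).1

lemma card_le [Finite V] (w : Fin M → V)
    (hend : ∀ x ∈ A, (∀ i, f i x = 0) → x ∈ H) :
    A.card ≤ Nat.card H + ∑ i, (starArm A w f i).card := by
  classical
  have hsub : A ⊆ A.filter (fun x => x ∈ H) ∪
      Finset.univ.biUnion (fun i => A.filter (fun x => f i x = 1)) := by
    intro x hx
    rw [Finset.mem_union]
    by_cases h : ∃ i, f i x = 1
    · obtain ⟨i, hi⟩ := h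
      exact Or.inr (Finset.mem_biUnion.2 ⟨i, Finset.mem_univ i, Finset.mem_filter.2 ⟨hx, hi⟩⟩)
    · push Not at h
      exact Or.inl (Finset.mem_filter.2
        ⟨hx, hend x hx fun i => (zmod_two_cases _).resolve_right (h i)⟩)
  refine (Finset.card_le_card hsub).trans ((Finset.card_union_le _ _).trans (add_le_add ?_ ?_))
  · exact card_le_natCard_of_forall_mem fun x hx => (Finset.mem_filter.1 hx).2
  · simp only [card_starArm]
    exact Finset.card_biUnion_le

/-- The sumset splits according to which `f i` equal `1`. The empty support contains `H`, each
singleton contains `w i + H`, each two-element support contains a translated sum of two arms; larger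
supports are discarded. -/
lemma le_card_add [Finite V] (hs : IsPartialStar H A w f) :
    (Nat.card H : ℝ) * (1 + M) +
      (∑ i, ∑ k, if i = k then 0 else ((starArm A w f i + starArm A w f k).card : ℝ)) / 2 ≤
      ((A + A).card : ℝ) := by
  set supp : V → Finset (Fin M) := fun z => Finset.univ.filter (fun i => f i z = 1) with hsupp
  have hmem : ∀ z s, (∀ i, f i z = if i ∈ s then 1 else 0) → supp z = s := by
    intro z s h
    ext i
    rw [hsupp, Finset.mem_filter, h i]
    simp
  set c : Finset (Fin M) → ℝ := fun s => (((A + A).filter (fun z => supp z = s)).card : ℝ) with hc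
  have htot : ((A + A).card : ℝ) = ∑ s, c s := by
    rw [Finset.card_eq_sum_card_fiberwise (f := supp) (t := Finset.univ)
      (fun x _ => Finset.mem_univ _)]
    push_cast
    rfl
  have hw : ∀ i k, f i (w k) = if i = k then 1 else 0 := by
    intro i k
    split_ifs with h
    · rw [h, hs.map_self]
    · exact hs.map_ne i k h
  have h0 : (Nat.card H : ℝ) ≤ c ∅ := by
    rw [hc]
    refine Nat.cast_le.2 (natCard_le_card_of_forall_mem fun h hh => Finset.mem_filter.2 ⟨?_, ?_⟩)
    · have := Finset.add_mem_add (hs.subset h hh) (hs.subset 0 H.zero_mem)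
      rwa [add_zero] at this
    · exact hmem h ∅ fun i => by simp [hs.map_sub i h hh]
  have h1 : ∀ i, (Nat.card H : ℝ) ≤ c {i} := by
    intro i
    rw [hc]
    refine Nat.cast_le.2 (natCard_le_card_of_coset (w i)
      fun h hh => Finset.mem_filter.2 ⟨?_, ?_⟩)
    · exact Finset.add_mem_add (hs.mem i) (hs.subset h hh)
    · refine hmem _ {i} fun k => ?_
      rw [map_add, hs.map_sub k h hh, add_zero, hw]
      simp
  have h2 : ∀ i k, i ≠ k → ((starArm A w f i + starArm A w f k).card : ℝ) ≤ c {i, k} := by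
    intro i k hik
    rw [hc, ← Finset.card_image_of_injective _ (add_left_injective (w i + w k))]
    refine Nat.cast_le.2 (Finset.card_le_card fun z hz => ?_)
    obtain ⟨u, hu, rfl⟩ := Finset.mem_image.1 hz
    obtain ⟨x, hx, x', hx', rfl⟩ := Finset.mem_add.1 hu
    refine Finset.mem_filter.2 ⟨?_, ?_⟩
    · have := Finset.add_mem_add (add_mem_of_mem_starArm hx) (add_mem_of_mem_starArm hx')
      rwa [add_add_add_comm] at this
    · refine hmem _ {i, k} fun m => ?_
      simp only [map_add, hs.map_sub m x (hs.starArm_subset i x hx),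
        hs.map_sub m x' (hs.starArm_subset k x' hx'), hw, zero_add, Finset.mem_insert,
        Finset.mem_singleton]
      by_cases hmi : m = i
      · have : m ≠ k := fun h => hik (hmi ▸ h)
        simp [hmi, hik]
      · simp [hmi]
  rw [htot]
  refine le_trans ?_ (sum_small_le_sum (c := c) fun s => Nat.cast_nonneg _)
  have s1 : (M : ℝ) * Nat.card H ≤ ∑ i, c {i} := by
    have := Finset.card_nsmul_le_sum Finset.univ (fun i => c {i}) (Nat.card H : ℝ) fun i _ => h1 i
    simpa using this
  have s2 : (∑ i, ∑ k, if i = k then 0 else ((starArm A w f i + starArm A w f k).card : ℝ)) ≤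
      ∑ i, ∑ k, if i = k then 0 else c {i, k} := by
    refine Finset.sum_le_sum fun i _ => Finset.sum_le_sum fun k _ => ?_
    split_ifs with h
    · exact le_rfl
    · exact h2 i k h
  linarith

lemma isStarProfile [Finite V] (hs : IsPartialStar H A w f)
    (hpair : ∀ i k, i ≠ k → (starArm A w f i).card + (starArm A w f k).card ≤ Nat.card H) :
    IsStarProfile (fun i => ((starArm A w f i).card : ℝ) / Nat.card H)
      (fun i k => if i = k then 0 else
        ((starArm A w f i + starArm A w f k).card : ℝ) / Nat.card H) := by
  obtain ⟨d, hd⟩ := exists_natCard_eq_two_pow H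
  have hN : (0 : ℝ) < Nat.card H := by exact_mod_cast Nat.card_pos
  have hpos : ∀ i, 0 < (starArm A w f i).card := fun i => (hs.starArm_nonempty i).card_pos
  have hsum : ∀ i k, 0 < (starArm A w f i + starArm A w f k).card := fun i k =>
    ((hs.starArm_nonempty i).add (hs.starArm_nonempty k)).card_pos
  have hpow : ∀ i k (j : ℕ), 2 ^ j < (starArm A w f i).card + (starArm A w f k).card →
      2 ^ j ≤ (starArm A w f i + starArm A w f k).card := fun i k j h =>
    two_pow_le_card_add (hs.starArm_subset i) (hs.starArm_subset k) (hs.starArm_nonempty i)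
      (hs.starArm_nonempty k) h
  refine ⟨fun i => if_pos rfl, fun i k => ?_, fun i => ?_, fun i k hik => ?_, fun i k hik => ?_,
    fun i k hik h => ?_, fun i k hik h => ?_, fun i k hik h h' => ?_⟩
  · rw [add_comm (starArm A w f i)]
    simp only [eq_comm]
  · exact div_pos (by exact_mod_cast hpos i) hN
  · rw [← add_div, div_le_one hN]
    exact_mod_cast hpair i k hik
  · rw [if_neg hik]
    refine div_le_div_of_nonneg_right ?_ hN.le
    exact_mod_cast Finset.card_le_card_add_right (hs.starArm_nonempty k)
  · rw [if_neg hik, le_div_iff₀ hN]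
    rw [← add_div, lt_div_iff₀ hN] at h
    have h1 : Nat.card H < 2 * ((starArm A w f i).card + (starArm A w f k).card) := by
      have : (Nat.card H : ℝ) < 2 * ((starArm A w f i).card + (starArm A w f k).card) := by linarith
      exact_mod_cast this
    have h2 : Nat.card H ≤ 2 * (starArm A w f i + starArm A w f k).card := by
      have p1 := hpos i
      have p2 := hpos k
      have p3 := hpair i k hik
      -- A trivial `H` is impossible, as two nonempty arms would exceed it.
      cases d with
      | zero => rw [hd, pow_zero] at p3; omega
      | succ d =>
        rw [pow_succ] at hd
        have := hpow i k d (by omega)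
        omega
    have h3 : (Nat.card H : ℝ) ≤ 2 * (starArm A w f i + starArm A w f k).card := by
      exact_mod_cast h2
    linarith
  · rw [if_neg hik, le_div_iff₀ hN]
    rw [← add_div, lt_div_iff₀ hN] at h
    have h1 : Nat.card H < 4 * ((starArm A w f i).card + (starArm A w f k).card) := by
      have : (Nat.card H : ℝ) < 4 * ((starArm A w f i).card + (starArm A w f k).card) := by linarith
      exact_mod_cast this
    have h2 : Nat.card H ≤ 4 * (starArm A w f i + starArm A w f k).card := by
      have p1 := hsum i k
      -- When `|H| ≤ 2` a single point of the sumset is enough.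
      rcases d with _ | _ | d
      · rw [hd, pow_zero]; omega
      · rw [hd, zero_add, pow_one]; omega
      · rw [pow_succ, pow_succ] at hd
        have := hpow i k d (by omega)
        omega
    have h3 : (Nat.card H : ℝ) ≤ 4 * (starArm A w f i + starArm A w f k).card := by
      exact_mod_cast h2
    linarith
  · rw [if_neg hik, le_div_iff₀ hN, add_mul, div_mul_cancel₀ _ hN.ne']
    rw [lt_div_iff₀ hN] at h
    rw [div_le_iff₀ hN] at h'
    have h1 : Nat.card H < 2 * (starArm A w f i).card := by
      have : (Nat.card H : ℝ) < 2 * (starArm A w f i).card := by linarith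
      exact_mod_cast this
    have h2 : 2 * (starArm A w f k).card ≤ Nat.card H := by
      have : 2 * ((starArm A w f k).card : ℝ) ≤ Nat.card H := by linarith
      exact_mod_cast this
    have h3 := natCard_add_two_mul_card_le (hs.starArm_subset i) (hs.starArm_subset k)
      (hs.starArm_nonempty k) h1 h2
    have h4 : (Nat.card H : ℝ) + 2 * (starArm A w f k).card ≤
        2 * (starArm A w f i + starArm A w f k).card := by exact_mod_cast h3
    linarith

end IsPartialStar

theorem exists_meetsBound [Finite V] {A : Finset V} (hA : AffinelyGenerates A)
    (hne : A.Nonempty) :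
    ∃ (N M : ℕ) (D α : ℝ), 0 < N ∧ Nat.card V = N * 2 ^ M ∧ (A.card : ℝ) ≤ N * α ∧
      N * D ≤ ((A + A).card : ℝ) ∧ MeetsBound M D α := by
  obtain ⟨H, B, M, w, f, hBc, hBs, hs, hend, hV, hpair⟩ := exists_star hA hne
  have hN : (0 : ℝ) < Nat.card H := by exact_mod_cast Nat.card_pos
  have hadd := hs.le_card_add
  have hBs' : ((B + B).card : ℝ) ≤ (A + A).card := by exact_mod_cast hBs
  rcases Nat.lt_or_ge M 2 with hM | hM
  -- For `M ≤ 1`, `2 ^ M = 1 + M`, so the sumset already has `|V|` points, and at `t = 1` density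
  -- and breakpoint are both `1`.
  · refine ⟨Nat.card H, M, 2 ^ M, 2 ^ M, Nat.card_pos, hV, ?_, ?_, 1, Or.inl ⟨le_rfl, ?_, ?_⟩⟩
    · have h1 := card_le_natCard_of_forall_mem (P := (⊤ : Submodule (ZMod 2) V)) (X := A)
        (fun _ _ => Submodule.mem_top)
      rw [Nat.card_congr (Submodule.topEquiv (R := ZMod 2) (M := V)).toEquiv, hV] at h1
      exact_mod_cast h1
    · have h1 : (0 : ℝ) ≤ ∑ i, ∑ k, if i = k then 0 else
          ((starArm B w f i + starArm B w f k).card : ℝ) :=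
        Finset.sum_nonneg fun i _ => Finset.sum_nonneg fun k _ => by split_ifs <;> positivity
      have h2 : (2 : ℝ) ^ M = 1 + M := by interval_cases M <;> norm_num
      rw [h2]
      linarith
    · rw [ballDensity]; norm_num
    · rw [breakpoint]; norm_num
  · have hprof := hs.isStarProfile fun i k hik => by
      rw [card_starArm, card_starArm]; exact hpair i k hik
    have hmeet := hprof.meetsBound (by rwa [Fintype.card_fin])
    rw [Fintype.card_fin] at hmeet
    refine ⟨Nat.card H, M, _, _, Nat.card_pos, hV, ?_, ?_, hmeet⟩
    · have h1 : (B.card : ℝ) ≤ Nat.card H + ∑ i, ((starArm B w f i).card : ℝ) := by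
        exact_mod_cast IsPartialStar.card_le w hend
      rw [← hBc, ← Finset.sum_div, mul_add, mul_one, mul_div_cancel₀ _ hN.ne']
      exact h1
    · refine le_trans (le_of_eq ?_) (hadd.trans hBs')
      have h1 : (∑ i, ∑ k, if i = k then 0 else
          ((starArm B w f i + starArm B w f k).card : ℝ) / Nat.card H) =
          (∑ i, ∑ k, if i = k then 0 else
            ((starArm B w f i + starArm B w f k).card : ℝ)) / Nat.card H := by
        rw [Finset.sum_div]
        refine Finset.sum_congr rfl fun i _ => ?_
        rw [Finset.sum_div]
        refine Finset.sum_congr rfl fun k _ => ?_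
        split_ifs
        · rw [zero_div]
        · rfl
      have h2 : ∀ S : ℝ, (Nat.card H : ℝ) * (1 + M + S / Nat.card H / 2) =
          Nat.card H * (1 + M) + S / 2 := fun S => by field_simp
      rw [h1, h2]

end StarSumset

/-! ### The upper bound for the spanning constant. -/

section UpperBound

lemma vectorSpan_eq_top_iff {V : Type*} [AddCommGroup V] [Module (ZMod 2) V] {A : Finset V} :
    vectorSpan (ZMod 2) (A : Set V) = ⊤ ↔ AffinelyGenerates A := by
  constructor
  · intro h φ hφ
    have h1 : vectorSpan (ZMod 2) (A : Set V) ≤ LinearMap.ker φ := by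
      rw [vectorSpan_def, Submodule.span_le]
      rintro _ ⟨a, ha, b, hb, rfl⟩
      change φ (a - b) = 0
      rw [map_sub, hφ a ha b hb, sub_self]
    rw [h, top_le_iff] at h1
    exact LinearMap.ker_eq_top.1 h1
  · intro h
    by_contra hne
    obtain ⟨v, -, hv⟩ := SetLike.exists_of_lt (lt_top_iff_ne_top.2 hne)
    obtain ⟨f, hf, hfv⟩ := exists_functional_eq_one hv
    have h0 := h f fun a ha b hb => by
      have := hf _ (vsub_mem_vectorSpan (ZMod 2) (Finset.mem_coe.2 ha) (Finset.mem_coe.2 hb))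
      rwa [vsub_eq_sub, map_sub, sub_eq_zero] at this
    rw [h0] at hfv
    exact absurd hfv (by simp)

/-- A set of affine rank `dim W` can be placed in the subgroup `W` that directs its affine span. -/
lemma exists_affinelyGenerates_of_nonempty {n : ℕ} {A : Finset (Fin n → ZMod 2)}
    (hA : A.Nonempty) :
    ∃ (W : Submodule (ZMod 2) (Fin n → ZMod 2)) (B : Finset W), AffinelyGenerates B ∧
      B.Nonempty ∧ B.card = A.card ∧ (B + B).card ≤ (A + A).card ∧
      Nat.card (affineSpan (ZMod 2) (A : Set (Fin n → ZMod 2))) = Nat.card W := by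
  classical
  obtain ⟨a, ha⟩ := hA
  set W := vectorSpan (ZMod 2) (A : Set (Fin n → ZMod 2)) with hW
  have haA : a ∈ (A : Set (Fin n → ZMod 2)) := Finset.mem_coe.2 ha
  set B : Finset W := Finset.univ.filter (fun u : W => (u : Fin n → ZMod 2) + a ∈ A) with hB
  have hinj : Function.Injective (fun u : W => (u : Fin n → ZMod 2) + a) := fun u v h =>
    Subtype.ext (add_right_cancel h)
  have himg : B.image (fun u : W => (u : Fin n → ZMod 2) + a) = A := by
    ext x
    rw [Finset.mem_image]
    constructor
    · rintro ⟨u, hu, rfl⟩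
      exact (Finset.mem_filter.1 hu).2
    · intro hx
      have hxW : x - a ∈ W := vsub_mem_vectorSpan (ZMod 2) (Finset.mem_coe.2 hx) haA
      exact ⟨⟨x - a, hxW⟩, Finset.mem_filter.2 ⟨Finset.mem_univ _, by simpa using hx⟩,
        sub_add_cancel x a⟩
  have h0B : (0 : W) ∈ B := Finset.mem_filter.2 ⟨Finset.mem_univ _, by simpa using ha⟩
  refine ⟨W, B, ?_, ⟨0, h0B⟩, ?_, ?_, ?_⟩
  · intro φ hφ
    have hφB : ∀ b ∈ B, φ b = 0 := fun b hb => by rw [hφ b hb 0 h0B, map_zero]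
    ext ⟨u, hu⟩
    have hspan : W = Submodule.span (ZMod 2) ((· -ᵥ a) '' (A : Set (Fin n → ZMod 2))) :=
      vectorSpan_eq_span_vsub_set_right (ZMod 2) haA
    have key : ∀ u ∈ Submodule.span (ZMod 2) ((· -ᵥ a) '' (A : Set (Fin n → ZMod 2))),
        ∀ hu : u ∈ W, φ ⟨u, hu⟩ = 0 := by
      intro u hu
      induction hu using Submodule.span_induction with
      | mem x hx =>
        obtain ⟨y, hy, rfl⟩ := hx
        exact fun hu => hφB _ (Finset.mem_filter.2
          ⟨Finset.mem_univ _, by simpa using Finset.mem_coe.1 hy⟩)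
      | zero => exact fun hu => map_zero φ
      | add x y hx hy ihx ihy =>
        intro hu
        have hx' : x ∈ W := hspan ▸ hx
        have hy' : y ∈ W := hspan ▸ hy
        have : (⟨x + y, hu⟩ : W) = ⟨x, hx'⟩ + ⟨y, hy'⟩ := rfl
        rw [this, map_add, ihx hx', ihy hy', add_zero]
      | smul c x hx ihx =>
        intro hu
        have hx' : x ∈ W := hspan ▸ hx
        have : (⟨c • x, hu⟩ : W) = c • ⟨x, hx'⟩ := rfl
        rw [this, map_smul, ihx hx', smul_zero]
    exact key u (hspan ▸ hu) hu
  · rw [← himg, Finset.card_image_of_injective _ hinj]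
  -- The two shifts by `a` cancel in characteristic two, so `B + B` embeds in `A + A`.
  · rw [← Finset.card_image_of_injective (B + B) Subtype.val_injective]
    refine Finset.card_le_card fun x hx => ?_
    obtain ⟨u, hu, rfl⟩ := Finset.mem_image.1 hx
    obtain ⟨v, hv, v', hv', rfl⟩ := Finset.mem_add.1 hu
    have := Finset.add_mem_add (Finset.mem_filter.1 hv).2 (Finset.mem_filter.1 hv').2
    rwa [add_add_add_comm, ZModModule.add_self, add_zero] at this
  · have haS : a ∈ affineSpan (ZMod 2) (A : Set (Fin n → ZMod 2)) := subset_affineSpan _ _ haA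
    rw [hW, ← direction_affineSpan]
    refine Nat.card_congr
      { toFun := fun p => ⟨p.1 -ᵥ a, AffineSubspace.vsub_mem_direction p.2 haS⟩
        invFun := fun u => ⟨u.1 +ᵥ a, AffineSubspace.vadd_mem_of_mem_direction u.2 haS⟩
        left_inv := fun p => Subtype.ext (by simp)
        right_inv := fun u => Subtype.ext (by simp) }

lemma ballDensity_succ_le {t : ℕ} (ht : 1 ≤ t) : ballDensity (t + 1) ≤ ballDensity t := by
  have ht' : (1 : ℝ) ≤ t := by exact_mod_cast ht
  rw [ballDensity, ballDensity, div_le_div_iff₀ (by positivity) (by positivity),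
    pow_succ (2 : ℝ) (t + 1)]
  push_cast
  have h2 : (0 : ℝ) < 2 ^ (t + 1) := by positivity
  nlinarith [mul_nonneg h2.le (mul_nonneg (sub_nonneg.2 ht') (Nat.cast_nonneg t : (0 : ℝ) ≤ t))]

lemma ballDensity_anti {s t : ℕ} (hs : 1 ≤ s) (hst : s ≤ t) : ballDensity t ≤ ballDensity s := by
  induction t, hst using Nat.le_induction with
  | base => exact le_rfl
  | succ t ht ih => exact (ballDensity_succ_le (hs.trans ht)).trans ih

lemma midDensity_le_ballDensity (t : ℕ) : midDensity t ≤ ballDensity t := by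
  rw [midDensity, ballDensity]
  exact div_le_div_of_nonneg_right (by linarith) (by positivity)

/-- With `midDensity_le_ballDensity` this interlaces the two families of densities. It is an
equality at `t = 2` and false at `t = 1`. -/
lemma ballDensity_succ_le_midDensity {t : ℕ} (ht : 2 ≤ t) :
    ballDensity (t + 1) ≤ midDensity t := by
  have ht' : (2 : ℝ) ≤ t := by exact_mod_cast ht
  rw [ballDensity, midDensity, div_le_div_iff₀ (by positivity) (by positivity),
    pow_succ (2 : ℝ) (t + 1)]
  push_cast
  have h2 : (0 : ℝ) < 2 ^ (t + 1) := by positivity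
  nlinarith [mul_nonneg h2.le (mul_nonneg (sub_nonneg.2 ht') (by positivity : (0 : ℝ) ≤ t + 1))]

lemma breakpoint_le_midBreakpoint {t : ℕ} (ht : 1 ≤ t) : breakpoint t ≤ midBreakpoint t := by
  have ht' : (1 : ℝ) ≤ t := by exact_mod_cast ht
  rw [breakpoint_eq, midBreakpoint, div_le_div_iff₀ (by positivity) (by positivity)]
  nlinarith

/-- The reciprocal of the slope of `F` at `K`, when `K` lies between the breakpoints of `t` and
`t + 1`. -/
noncomputable def slopeDensity (t : ℕ) (K : ℝ) : ℝ :=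
  if K < midBreakpoint t then ballDensity t else midDensity t

lemma slopeDensity_pos (t : ℕ) (K : ℝ) : 0 < slopeDensity t K := by
  unfold slopeDensity
  split_ifs
  · exact ballDensity_pos t
  · exact midDensity_pos t

lemma midDensity_le_slopeDensity (t : ℕ) (K : ℝ) : midDensity t ≤ slopeDensity t K := by
  unfold slopeDensity
  split_ifs
  · exact midDensity_le_ballDensity t
  · exact le_rfl

lemma slopeDensity_le_ballDensity (t : ℕ) (K : ℝ) : slopeDensity t K ≤ ballDensity t := by
  unfold slopeDensity
  split_ifs
  · exact le_rfl
  · exact midDensity_le_ballDensity t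

lemma le_of_breakpoint_le {s t : ℕ} {K : ℝ} (h : breakpoint s ≤ K)
    (hK : K < breakpoint (t + 1)) : s ≤ t := by
  by_contra hlt
  push Not at hlt
  linarith [breakpoint_mono (by omega) (show t + 1 ≤ s from hlt)]

theorem spanningConstant_le {n : ℕ} {A : Finset (Fin n → ZMod 2)} (hA : A.Nonempty) {K : ℝ}
    (hAK : doublingConstant A ≤ K) {t : ℕ} (hK : K < breakpoint (t + 1)) :
    spanningConstant A ≤ K / slopeDensity t K := by
  classical
  obtain ⟨W, B, hB, hBn, hBc, hBs, hspan⟩ := exists_affinelyGenerates_of_nonempty hA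
  obtain ⟨N, M, D, α, hN, hV, hα, hD, s, hs⟩ := exists_meetsBound hB hBn
  have hA0 : (0 : ℝ) < A.card := by exact_mod_cast hA.card_pos
  have hN0 : (0 : ℝ) < N := by exact_mod_cast hN
  rw [doublingConstant, div_le_iff₀ hA0] at hAK
  rw [hBc] at hα
  have hDK : N * D ≤ K * A.card := by
    refine hD.trans (le_trans ?_ hAK)
    exact_mod_cast hBs
  have hbr : ∀ b : ℝ, 0 ≤ b → b * α ≤ D → b ≤ K := by
    intro b hb hbD
    refine le_of_mul_le_mul_right ?_ hA0
    have h1 := mul_le_mul_of_nonneg_left hα hb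
    have h2 := mul_le_mul_of_nonneg_left hbD hN0.le
    linarith
  have hfin : ∀ ρ : ℝ, slopeDensity t K ≤ ρ → 2 ^ M * ρ ≤ D →
      spanningConstant A ≤ K / slopeDensity t K := by
    intro ρ hρ hρD
    rw [spanningConstant, hspan, hV, div_le_div_iff₀ hA0 (slopeDensity_pos t K)]
    push_cast
    have h1 : (2 : ℝ) ^ M * slopeDensity t K ≤ D :=
      (mul_le_mul_of_nonneg_left hρ (by positivity)).trans hρD
    have h2 := mul_le_mul_of_nonneg_left h1 hN0.le
    linarith
  rcases hs with ⟨hs1, hsD, hsα⟩ | ⟨hs2, hsD, hsα⟩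
  · have hst : s ≤ t := le_of_breakpoint_le (hbr _ (by unfold breakpoint; positivity) hsα) hK
    exact hfin _ ((slopeDensity_le_ballDensity t K).trans (ballDensity_anti hs1 hst)) hsD
  · have hmid := hbr _ (by unfold midBreakpoint; positivity) hsα
    have hst : s ≤ t :=
      le_of_breakpoint_le ((breakpoint_le_midBreakpoint (by omega)).trans hmid) hK
    -- If `s = t`, then `K` is past the middle breakpoint and the slope density is `midDensity t`
    -- itself; if `s < t`, interlacing applies.
    rcases hst.eq_or_lt with rfl | hlt
    · refine hfin _ (le_of_eq ?_) hsD
      rw [slopeDensity, if_neg (not_lt.2 hmid)]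
    · exact hfin _ ((slopeDensity_le_ballDensity t K).trans
        ((ballDensity_anti (by omega) (show s + 1 ≤ t from hlt)).trans
          (ballDensity_succ_le_midDensity hs2))) hsD

end UpperBound

/-! ### Extremal examples and thinning. -/

section LowerBound

lemma AffinelyGenerates.affineSpan_eq_top {V : Type*} [AddCommGroup V] [Module (ZMod 2) V]
    {A : Finset V} (hA : AffinelyGenerates A) (hne : A.Nonempty) :
    affineSpan (ZMod 2) (A : Set V) = ⊤ :=
  (AffineSubspace.affineSpan_eq_top_iff_vectorSpan_eq_top_of_nonempty (ZMod 2) V V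
    (Finset.coe_nonempty.2 hne)).2 (vectorSpan_eq_top_iff.2 hA)

lemma AffinelyGenerates.mono {V : Type*} [AddCommGroup V] [Module (ZMod 2) V]
    {A B : Finset V} (hA : AffinelyGenerates A) (hAB : A ⊆ B) : AffinelyGenerates B :=
  fun φ hφ => hA φ fun a ha b hb => hφ a (hAB ha) b (hAB hb)

lemma AffinelyGenerates.exists_subset_card_le {V : Type*} [AddCommGroup V] [Module (ZMod 2) V]
    [Finite V] {A : Finset V} (hA : AffinelyGenerates A) (hne : A.Nonempty) :
    ∃ T ⊆ A, AffinelyGenerates T ∧ T.card ≤ Module.finrank (ZMod 2) V + 1 := by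
  classical
  obtain ⟨T, hTA, hspan, hind⟩ := exists_affineIndependent (ZMod 2) V (A : Set V)
  have hfin : T.Finite := Set.toFinite T
  refine ⟨hfin.toFinset, ?_, ?_, ?_⟩
  · intro x hx
    exact hTA (hfin.mem_toFinset.1 hx)
  · rw [← vectorSpan_eq_top_iff, hfin.coe_toFinset, ← direction_affineSpan, hspan,
      hA.affineSpan_eq_top hne, AffineSubspace.direction_top]
  · have : Fintype T := hfin.fintype
    have h1 := hind.card_le_finrank_succ
    rw [← Set.Finite.card_toFinset hfin] at h1
    exact h1.trans (Nat.add_le_add_right (Submodule.finrank_le _) 1)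

/-- Spanning constants may be computed in any finite vector space over `ℤ₂`. -/
lemma div_mem_spanningConstants {V : Type*} [AddCommGroup V] [Module (ZMod 2) V] [Finite V]
    [DecidableEq V] {A : Finset V} (hA : AffinelyGenerates A) (hne : A.Nonempty) {K : ℝ}
    (hK : ((A + A).card : ℝ) ≤ K * A.card) :
    (Nat.card V : ℝ) / A.card ∈ spanningConstants K := by
  set n := Module.finrank (ZMod 2) V with hn
  let e : V ≃ₗ[ZMod 2] (Fin n → ZMod 2) :=
    LinearEquiv.ofFinrankEq V (Fin n → ZMod 2) (by rw [Module.finrank_fin_fun])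
  set B := A.image e with hB
  have hBc : B.card = A.card := Finset.card_image_of_injective A e.injective
  have hBB : (B + B).card = (A + A).card := by
    rw [hB, ← Finset.image_add e, Finset.card_image_of_injective _ e.injective]
  have hBn : B.Nonempty := hne.image e
  have hBg : AffinelyGenerates B := by
    intro φ hφ
    have h1 := hA (φ.comp e.toLinearMap) fun a ha b hb =>
      hφ _ (Finset.mem_image_of_mem e ha) _ (Finset.mem_image_of_mem e hb)
    refine LinearMap.ext fun x => ?_
    have h2 := LinearMap.congr_fun h1 (e.symm x)
    simpa using h2
  refine ⟨n, B, hBn, ?_, ?_⟩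
  · rw [doublingConstant, hBB, hBc, div_le_iff₀ (by exact_mod_cast hne.card_pos)]
    exact hK
  · rw [spanningConstant, hBc, hBg.affineSpan_eq_top hBn]
    congr 2
    rw [Nat.card_congr e.toEquiv]
    exact (Nat.card_congr (Equiv.Set.univ _)).symm

lemma exists_large_two_pow (X : ℝ) (d : ℕ) {c : ℝ} (hc : 0 < c) :
    ∃ N : ℕ, X < 2 ^ N ∧ ((d + N + 1 : ℕ) : ℝ) ≤ c * 2 ^ N := by
  have h1 := (tendsto_pow_atTop_atTop_of_one_lt (r := (2 : ℝ)) (by norm_num)).eventually_gt_atTop X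
  have h2 := (tendsto_pow_const_div_const_pow_of_one_lt 1 (r := (2 : ℝ)) (by norm_num)).eventually
    (gt_mem_nhds (show (0 : ℝ) < c / (d + 2) by positivity))
  obtain ⟨N, ⟨hN1, hN2⟩, hN3⟩ := ((h1.and h2).and (Filter.eventually_ge_atTop 1)).exists
  refine ⟨N, hN1, ?_⟩
  have hN3' : (1 : ℝ) ≤ N := by exact_mod_cast hN3
  have hpow : (0 : ℝ) < 2 ^ N := by positivity
  rw [div_lt_iff₀ hpow, pow_one, div_mul_eq_mul_div, lt_div_iff₀ (by positivity)] at hN2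
  push_cast
  nlinarith [Nat.cast_nonneg (α := ℝ) d]

/-- Thinning the blow-ups of a generating set `B` yields spanning constants close to
`K |V| / σ`. -/
lemma exists_mem_spanningConstants_gt {V : Type*} [AddCommGroup V] [Module (ZMod 2) V] [Finite V]
    [DecidableEq V] {B : Finset V} (hB : AffinelyGenerates B) (hne : B.Nonempty) {σ : ℕ}
    (hσ : (B + B).card ≤ σ) {K : ℝ} (hK : (σ : ℝ) ≤ K * B.card) {x : ℝ}
    (hx : x < Nat.card V * K / σ) : ∃ z ∈ spanningConstants K, x < z := by
  have hσ1 : 1 ≤ σ := (hne.add hne).card_pos.trans_le hσ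
  have hσ0 : (0 : ℝ) < σ := by exact_mod_cast hσ1
  have hB0 : (0 : ℝ) < B.card := by exact_mod_cast hne.card_pos
  have hK0 : 0 < K := by
    by_contra hcon
    push Not at hcon
    nlinarith
  set R : ℝ := (Nat.card V : ℝ) with hR
  have hR0 : 0 < R := by rw [hR]; exact_mod_cast Nat.card_pos
  -- The first bound makes the rounding in `a` harmless; the second leaves room for a generating
  -- subset of at most `dim + 1` points.
  obtain ⟨N, hN1, hN2⟩ := exists_large_two_pow (x * K / (R * K - x * σ))
    (Module.finrank (ZMod 2) V) (show 0 < σ / K by positivity)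
  rw [lt_div_iff₀ hσ0] at hx
  rw [div_lt_iff₀ (by linarith)] at hN1
  set q : ℝ := 2 ^ N with hq
  have hq0 : 0 < q := by positivity
  set E : Finset (V × (Fin N → ZMod 2)) := B ×ˢ Finset.univ with hE
  have hcardW : Fintype.card (Fin N → ZMod 2) = 2 ^ N := by simp
  have hEc : (E.card : ℝ) = B.card * q := by
    rw [hE, Finset.card_product, Finset.card_univ, hcardW]
    push_cast
    rfl
  have hEg : AffinelyGenerates E := by
    intro φ hφ
    obtain ⟨b₀, hb₀⟩ := hne
    have h1 := hB (φ.comp (LinearMap.inl _ _ _)) fun a ha b hb =>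
      hφ (a, 0) (Finset.mk_mem_product ha (Finset.mem_univ _)) (b, 0)
        (Finset.mk_mem_product hb (Finset.mem_univ _))
    have h2 : ∀ u, φ (0, u) = 0 := by
      intro u
      have := hφ (b₀, u) (Finset.mk_mem_product hb₀ (Finset.mem_univ _)) (b₀, 0)
        (Finset.mk_mem_product hb₀ (Finset.mem_univ _))
      have e1 : (b₀, u) = (b₀, (0 : Fin N → ZMod 2)) + (0, u) := by simp
      rw [e1, map_add] at this
      simpa using this
    refine LinearMap.ext fun p => ?_
    have e1 : p = (p.1, (0 : Fin N → ZMod 2)) + (0, p.2) := by simp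
    have h3 := LinearMap.congr_fun h1 p.1
    rw [e1, map_add, h2, add_zero]
    exact h3
  have hEn : E.Nonempty := hne.product Finset.univ_nonempty
  obtain ⟨T, hTE, hTg, hTc⟩ := hEg.exists_subset_card_le hEn
  have hfr : Module.finrank (ZMod 2) (V × (Fin N → ZMod 2)) = Module.finrank (ZMod 2) V + N := by
    rw [Module.finrank_prod, Module.finrank_fin_fun]
  rw [hfr] at hTc
  -- The smallest size compatible with doubling at most `K`, given that the sumset stays inside `(B
  -- + B) × ℤ₂ᴺ`.
  set a := ⌈σ / K * q⌉₊ with ha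
  have ha1 : σ / K * q ≤ a := Nat.le_ceil _
  have ha2 : (a : ℝ) < σ / K * q + 1 := Nat.ceil_lt_add_one (by positivity)
  have hTa : T.card ≤ a := by
    have : (T.card : ℝ) ≤ a := (Nat.cast_le.2 hTc).trans (hN2.trans ha1)
    exact_mod_cast this
  have haE : a ≤ E.card := by
    refine Nat.ceil_le.2 ?_
    rw [hEc]
    refine mul_le_mul_of_nonneg_right ?_ hq0.le
    rwa [div_le_iff₀' hK0]
  obtain ⟨A, hTA, hAE, hAc⟩ := Finset.exists_subsuperset_card_eq hTE hTa haE
  have hAg := hTg.mono hTA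
  have ha0 : (0 : ℝ) < a := lt_of_lt_of_le (by positivity) ha1
  have hAn : A.Nonempty := Finset.card_pos.1 (by rw [hAc]; exact_mod_cast ha0)
  have hsum : ((A + A).card : ℝ) ≤ σ * q := by
    have h1 : A + A ⊆ (B + B) ×ˢ (Finset.univ : Finset (Fin N → ZMod 2)) := by
      intro z hz
      obtain ⟨u, hu, v, hv, rfl⟩ := Finset.mem_add.1 hz
      exact Finset.mem_product.2 ⟨Finset.add_mem_add (Finset.mem_product.1 (hAE hu)).1
        (Finset.mem_product.1 (hAE hv)).1, Finset.mem_univ _⟩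
    have h2 : (A + A).card ≤ σ * 2 ^ N := by
      refine (Finset.card_le_card h1).trans ?_
      rw [Finset.card_product, Finset.card_univ, hcardW]
      exact Nat.mul_le_mul_right _ hσ
    rw [hq]
    exact_mod_cast h2
  refine ⟨_, div_mem_spanningConstants hAg hAn (K := K) ?_, ?_⟩
  · refine hsum.trans ?_
    rw [hAc]
    have h1 := mul_le_mul_of_nonneg_left ha1 hK0.le
    have h2 : K * (σ / K * q) = σ * q := by field_simp
    linarith
  · have hVW : (Nat.card (V × (Fin N → ZMod 2)) : ℝ) = R * q := by
      rw [Nat.card_prod, Nat.card_eq_fintype_card (α := Fin N → ZMod 2), hcardW]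
      push_cast
      rfl
    rw [hVW, hAc, lt_div_iff₀ ha0]
    rcases le_or_gt x 0 with hx0 | hx0
    · nlinarith [mul_pos hR0 hq0]
    · have h1 : x * a < x * (σ / K * q + 1) := mul_lt_mul_of_pos_left ha2 hx0
      refine h1.trans ?_
      refine lt_of_mul_lt_mul_left ?_ hK0.le
      have h2 : K * (x * (σ / K * q + 1)) = x * σ * q + x * K := by field_simp
      rw [h2]
      linarith

/-- In characteristic two all sums `x + x` collapse to `0`. -/
lemma card_add_self_le {V : Type*} [AddCommGroup V] [Module (ZMod 2) V] [DecidableEq V]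
    (B : Finset V) : (B + B).card ≤ 1 + B.card.choose 2 := by
  have hsub : B + B ⊆ insert 0 ((B.powersetCard 2).image (fun s => ∑ x ∈ s, x)) := by
    intro z hz
    obtain ⟨x, hx, y, hy, rfl⟩ := Finset.mem_add.1 hz
    rw [Finset.mem_insert]
    by_cases hxy : x = y
    · left; rw [hxy, ZModModule.add_self]
    · right
      refine Finset.mem_image.2 ⟨{x, y}, Finset.mem_powersetCard.2 ⟨?_, Finset.card_pair hxy⟩,
        Finset.sum_pair hxy⟩
      intro u hu
      rcases Finset.mem_insert.1 hu with rfl | hu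
      · exact hx
      · rwa [Finset.mem_singleton.1 hu]
  refine (Finset.card_le_card hsub).trans ((Finset.card_insert_le _ _).trans ?_)
  rw [add_comm, ← Finset.card_powersetCard]
  exact Nat.add_le_add_left Finset.card_image_le 1

/-- The Hamming ball of radius `1`. -/
def hammingOne (t : ℕ) : Finset (Fin t → ZMod 2) :=
  insert 0 (Finset.univ.image fun i => Pi.single i 1)

lemma zero_mem_hammingOne (t : ℕ) : (0 : Fin t → ZMod 2) ∈ hammingOne t :=
  Finset.mem_insert_self _ _

lemma single_mem_hammingOne {t : ℕ} (i : Fin t) : Pi.single i 1 ∈ hammingOne t :=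
  Finset.mem_insert_of_mem (Finset.mem_image_of_mem _ (Finset.mem_univ i))

lemma single_one_injective (t : ℕ) :
    Function.Injective (fun i : Fin t => (Pi.single i 1 : Fin t → ZMod 2)) := by
  intro i k h
  replace h : (Pi.single i 1 : Fin t → ZMod 2) = Pi.single k 1 := h
  by_contra hne
  have := congrFun h i
  rw [Pi.single_eq_same, Pi.single_eq_of_ne hne] at this
  exact absurd this (by decide)

lemma card_hammingOne (t : ℕ) : (hammingOne t).card = t + 1 := by
  rw [hammingOne, Finset.card_insert_of_notMem,
    Finset.card_image_of_injective _ (single_one_injective t), Finset.card_univ, Fintype.card_fin]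
  rw [Finset.mem_image]
  rintro ⟨i, -, hi⟩
  have := congrFun hi i
  rw [Pi.single_eq_same] at this
  exact absurd this (by simp)

lemma eq_zero_of_forall_single {t : ℕ} {φ : (Fin t → ZMod 2) →ₗ[ZMod 2] ZMod 2}
    (h : ∀ i, φ (Pi.single i 1) = 0) : φ = 0 := by
  refine LinearMap.pi_ext' fun i => LinearMap.ext_ring ?_
  exact h i

lemma hammingOne_generates (t : ℕ) : AffinelyGenerates (hammingOne t) := by
  intro φ hφ
  refine eq_zero_of_forall_single fun i => ?_
  rw [hφ _ (single_mem_hammingOne i) 0 (zero_mem_hammingOne t), map_zero]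

/-- The double of the Hamming ball of radius `1`, with two points removed. -/
def doubledHamming {t : ℕ} (a b : Fin t) : Finset (ZMod 2 × (Fin t → ZMod 2)) :=
  ((Finset.univ ×ˢ hammingOne t).erase (1, Pi.single a 1)).erase (1, Pi.single b 1)

section DoubledHamming

variable {t : ℕ} {a b : Fin t}

lemma mem_doubledHamming {p : ZMod 2 × (Fin t → ZMod 2)} : p ∈ doubledHamming a b ↔
    p ≠ (1, Pi.single b 1) ∧ p ≠ (1, Pi.single a 1) ∧ p.2 ∈ hammingOne t := by
  simp [doubledHamming]

lemma card_doubledHamming (hab : a ≠ b) : (doubledHamming a b).card = 2 * t := by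
  have h1 : ((1 : ZMod 2), (Pi.single b 1 : Fin t → ZMod 2)) ≠ (1, Pi.single a 1) := fun h =>
    hab (single_one_injective t (congrArg Prod.snd h)).symm
  rw [doubledHamming, Finset.card_erase_of_mem, Finset.card_erase_of_mem, Finset.card_product,
    Finset.card_univ, ZMod.card, card_hammingOne]
  · omega
  · exact Finset.mk_mem_product (Finset.mem_univ _) (single_mem_hammingOne a)
  · exact Finset.mem_erase.2
      ⟨h1, Finset.mk_mem_product (Finset.mem_univ _) (single_mem_hammingOne b)⟩

lemma doubledHamming_generates : AffinelyGenerates (doubledHamming a b) := by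
  have hne : ∀ i : Fin t, (Pi.single i 1 : Fin t → ZMod 2) ≠ 0 := by
    intro i h
    have := congrFun h i
    rw [Pi.single_eq_same] at this
    exact absurd this (by simp)
  intro φ hφ
  have m0 : ((0 : ZMod 2), (0 : Fin t → ZMod 2)) ∈ doubledHamming a b :=
    mem_doubledHamming.2 ⟨fun h => absurd (congrArg Prod.fst h) (by simp),
      fun h => absurd (congrArg Prod.fst h) (by simp), zero_mem_hammingOne t⟩
  have m1 : ((1 : ZMod 2), (0 : Fin t → ZMod 2)) ∈ doubledHamming a b :=
    mem_doubledHamming.2 ⟨fun h => hne b (congrArg Prod.snd h).symm,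
      fun h => hne a (congrArg Prod.snd h).symm, zero_mem_hammingOne t⟩
  have m2 : ∀ i, ((0 : ZMod 2), (Pi.single i 1 : Fin t → ZMod 2)) ∈ doubledHamming a b := fun i =>
    mem_doubledHamming.2 ⟨fun h => absurd (congrArg Prod.fst h) (by simp),
      fun h => absurd (congrArg Prod.fst h) (by simp), single_mem_hammingOne i⟩
  have h0 : ∀ p ∈ doubledHamming a b, φ p = 0 := fun p hp => by
    rw [hφ p hp _ m0]; exact map_zero φ
  refine LinearMap.prod_ext ?_ ?_
  · refine LinearMap.ext_ring ?_
    exact h0 _ m1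
  · rw [LinearMap.zero_comp]
    refine eq_zero_of_forall_single fun i => ?_
    exact h0 _ (m2 i)

/-- Two elements of the Hamming ball of radius `1` with sum `e_a + e_b` are `e_a` and `e_b`. -/
lemma eq_single_of_add_eq (hab : a ≠ b) {u v : Fin t → ZMod 2} (hu : u ∈ hammingOne t)
    (hv : v ∈ hammingOne t) (huv : u + v = Pi.single a 1 + Pi.single b 1) :
    (u = Pi.single a 1 ∧ v = Pi.single b 1) ∨ (u = Pi.single b 1 ∧ v = Pi.single a 1) := by
  have ha : u a + v a = 1 := by
    have := congrFun huv a
    simpa [hab] using this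
  have hb : u b + v b = 1 := by
    have := congrFun huv b
    simpa [hab.symm] using this
  have hcase : ∀ x ∈ hammingOne t, (x a = 0 ∧ x b = 0) ∨ x = Pi.single a 1 ∨ x = Pi.single b 1 := by
    intro x hx
    rcases Finset.mem_insert.1 hx with rfl | hx
    · exact Or.inl ⟨rfl, rfl⟩
    · obtain ⟨i, -, rfl⟩ := Finset.mem_image.1 hx
      by_cases hia : i = a
      · exact Or.inr (Or.inl (by rw [hia]))
      · by_cases hib : i = b
        · exact Or.inr (Or.inr (by rw [hib]))
        · exact Or.inl ⟨Pi.single_eq_of_ne (Ne.symm hia) _, Pi.single_eq_of_ne (Ne.symm hib) _⟩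
  have hsa : (Pi.single a 1 : Fin t → ZMod 2) b = 0 := Pi.single_eq_of_ne hab.symm _
  have hsb : (Pi.single b 1 : Fin t → ZMod 2) a = 0 := Pi.single_eq_of_ne hab _
  rcases hcase u hu with ⟨u1, u2⟩ | rfl | rfl <;> rcases hcase v hv with ⟨v1, v2⟩ | rfl | rfl
  · rw [u1, v1] at ha; exact absurd ha (by decide)
  · rw [u2, hsa] at hb; exact absurd hb (by decide)
  · rw [u1, hsb] at ha; exact absurd ha (by decide)
  · rw [hsa, v2] at hb; exact absurd hb (by decide)
  · rw [hsa] at hb; exact absurd hb (by decide)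
  · exact Or.inl ⟨rfl, rfl⟩
  · rw [hsb, v1] at ha; exact absurd ha (by decide)
  · exact Or.inr ⟨rfl, rfl⟩
  · rw [hsb] at ha; exact absurd ha (by decide)

lemma card_doubledHamming_add_le (hab : a ≠ b) :
    (doubledHamming a b + doubledHamming a b).card ≤ t ^ 2 + t + 1 := by
  set z : ZMod 2 × (Fin t → ZMod 2) := (1, Pi.single a 1 + Pi.single b 1) with hz
  have hmem : ∀ p ∈ doubledHamming a b, p.2 = Pi.single a 1 ∨ p.2 = Pi.single b 1 → p.1 = 0 := by
    rintro ⟨c, u⟩ hp (h | h) <;> obtain ⟨h1, h2, -⟩ := mem_doubledHamming.1 hp <;>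
      rcases zmod_two_cases c with hc | hc
    · exact hc
    · exact absurd (Prod.ext hc h) h2
    · exact hc
    · exact absurd (Prod.ext hc h) h1
  -- Removing the two points costs the sumset the point `z`: its second coordinate only arises from
  -- the single vectors at `a` and `b`, over which only first coordinate `0` remains.
  have hsub : doubledHamming a b + doubledHamming a b ⊆
      (Finset.univ ×ˢ (hammingOne t + hammingOne t)).erase z := by
    intro x hx
    obtain ⟨p, hp, p', hp', rfl⟩ := Finset.mem_add.1 hx
    have h1 := (mem_doubledHamming.1 hp).2.2
    have h2 := (mem_doubledHamming.1 hp').2.2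
    refine Finset.mem_erase.2 ⟨fun h => ?_, Finset.mem_product.2
      ⟨Finset.mem_univ _, Finset.add_mem_add h1 h2⟩⟩
    have hfst : p.1 + p'.1 = 1 := congrArg Prod.fst h
    have hsnd : p.2 + p'.2 = Pi.single a 1 + Pi.single b 1 := congrArg Prod.snd h
    rcases eq_single_of_add_eq hab h1 h2 hsnd with ⟨e1, e2⟩ | ⟨e1, e2⟩
    · rw [hmem p hp (Or.inl e1), hmem p' hp' (Or.inr e2)] at hfst
      exact absurd hfst (by decide)
    · rw [hmem p hp (Or.inr e1), hmem p' hp' (Or.inl e2)] at hfst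
      exact absurd hfst (by decide)
  have hzmem : z ∈ (Finset.univ : Finset (ZMod 2)) ×ˢ (hammingOne t + hammingOne t) :=
    Finset.mk_mem_product (Finset.mem_univ _)
      (Finset.add_mem_add (single_mem_hammingOne a) (single_mem_hammingOne b))
  refine (Finset.card_le_card hsub).trans ?_
  rw [Finset.card_erase_of_mem hzmem, Finset.card_product, Finset.card_univ, ZMod.card]
  have h1 := card_add_self_le (hammingOne t)
  rw [card_hammingOne] at h1
  have h2 : 2 * (t + 1).choose 2 = t ^ 2 + t := by
    have := Nat.add_one_mul_choose_eq t 1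
    rw [Nat.choose_one_right] at this
    nlinarith
  omega

end DoubledHamming

theorem exists_mem_spanningConstants_gt_of_lt {t : ℕ} (ht : 1 ≤ t) {K : ℝ} (hK : breakpoint t ≤ K)
    (hK' : K < breakpoint (t + 1)) {x : ℝ} (hx : x < K / slopeDensity t K) :
    ∃ z ∈ spanningConstants K, x < z := by
  have ht' : (1 : ℝ) ≤ t := by exact_mod_cast ht
  unfold slopeDensity at hx
  split_ifs at hx with hmid
  · have hσ := card_add_self_le (hammingOne t)
    rw [card_hammingOne] at hσ
    have hcast : ((1 + (t + 1).choose 2 : ℕ) : ℝ) = ((t : ℝ) ^ 2 + t + 2) / 2 := by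
      rw [Nat.cast_add, Nat.cast_choose_two]
      push_cast
      ring
    refine exists_mem_spanningConstants_gt (hammingOne_generates t) ⟨0, zero_mem_hammingOne t⟩ hσ
      ?_ ?_
    · rw [hcast, card_hammingOne]
      rw [breakpoint_eq, div_le_iff₀ (by positivity)] at hK
      push_cast
      linarith
    · rw [hcast]
      refine hx.trans_le (le_of_eq ?_)
      rw [ballDensity, Nat.card_eq_fintype_card, Fintype.card_fun, ZMod.card, Fintype.card_fin]
      push_cast
      field_simp
      ring
  · push Not at hmid
    -- For `t = 1` this branch is empty, since the middle breakpoint `3/2` exceeds the next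
    -- breakpoint `4/3`.
    have ht2 : 2 ≤ t := by
      by_contra hcon
      obtain rfl : t = 1 := by omega
      rw [midBreakpoint] at hmid
      rw [breakpoint_eq] at hK'
      norm_num at hmid hK'
      linarith
    have hab : (⟨0, by omega⟩ : Fin t) ≠ ⟨1, by omega⟩ := by simp
    refine exists_mem_spanningConstants_gt doubledHamming_generates
      (Finset.card_pos.1 (by rw [card_doubledHamming hab]; omega))
      (card_doubledHamming_add_le hab) ?_ ?_
    · rw [card_doubledHamming hab]
      rw [midBreakpoint, div_le_iff₀ (by positivity)] at hmid
      push_cast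
      linarith
    · refine hx.trans_le (le_of_eq ?_)
      rw [midDensity, Nat.card_prod, Nat.card_zmod, Nat.card_eq_fintype_card, Fintype.card_fun,
        ZMod.card, Fintype.card_fin]
      push_cast
      field_simp
      ring

end LowerBound

/-! ### The value of `F` and its growth. -/

section Value

lemma breakpoint_one : breakpoint 1 = 1 := by
  rw [breakpoint_eq]; norm_num

lemma existsUnique_breakpoint_le {K : ℝ} (hK : 1 ≤ K) :
    ∃! t : ℕ, 1 ≤ t ∧ breakpoint t ≤ K ∧ K < breakpoint (t + 1) := by
  classical
  have hex : ∃ t : ℕ, K < breakpoint (t + 1) := by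
    obtain ⟨t, ht⟩ := exists_nat_gt (2 * K)
    refine ⟨t, ?_⟩
    rw [breakpoint_eq_add]
    have : (0 : ℝ) < 1 / (((t + 1 : ℕ) : ℝ) + 1) := by positivity
    push_cast at this ⊢
    linarith
  have hspec := Nat.find_spec hex
  have h0 : Nat.find hex ≠ 0 := by
    intro h
    rw [h, zero_add, breakpoint_one] at hspec
    linarith
  obtain ⟨s, hs⟩ := Nat.exists_eq_succ_of_ne_zero h0
  refine ⟨Nat.find hex, ⟨by omega, ?_, hspec⟩, fun u hu => ?_⟩
  · have := Nat.find_min hex (m := s) (by omega)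
    rw [hs]
    exact not_lt.1 this
  · refine le_antisymm (le_of_breakpoint_le hu.2.1 hspec) (le_of_breakpoint_le ?_ hu.2.2)
    have := Nat.find_min hex (m := s) (by omega)
    rw [hs]
    exact not_lt.1 this

theorem isLUB_spanningConstants {t : ℕ} (ht : 1 ≤ t) {K : ℝ} (hK : breakpoint t ≤ K)
    (hK' : K < breakpoint (t + 1)) :
    IsLUB (spanningConstants K) (K / slopeDensity t K) := by
  constructor
  · rintro x ⟨n, A, hA, hAK, rfl⟩
    exact spanningConstant_le hA hAK hK'
  · intro b hb
    by_contra hlt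
    push Not at hlt
    obtain ⟨z, hz, hbz⟩ := exists_mem_spanningConstants_gt_of_lt ht hK hK' hlt
    exact absurd (hb hz) (not_le.2 hbz)

theorem freimanF_eq {t : ℕ} (ht : 1 ≤ t) {K : ℝ} (hK : breakpoint t ≤ K)
    (hK' : K < breakpoint (t + 1)) : freimanF K = K / slopeDensity t K := by
  obtain ⟨z, hz, -⟩ := exists_mem_spanningConstants_gt_of_lt ht hK hK' (sub_one_lt _)
  exact (isLUB_spanningConstants ht hK hK').csSup_eq ⟨z, hz⟩

/-- Two-sided bounds for `F`. -/
lemma freimanF_bounds {K : ℝ} (hK : 2 ≤ K) :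
    freimanF K ≤ 2 * ((2 : ℝ) ^ (2 * K) / K) ∧ (2 : ℝ) ^ (2 * K) / K ≤ 12 * freimanF K := by
  obtain ⟨t, ⟨ht, h1, h2⟩, -⟩ := existsUnique_breakpoint_le (show 1 ≤ K by linarith)
  rw [freimanF_eq ht h1 h2]
  have hK0 : 0 < K := by linarith
  have ht' : (1 : ℝ) ≤ t := by exact_mod_cast ht
  rw [breakpoint_eq_add] at h1 h2
  push_cast at h2
  have e1 : (0 : ℝ) < 1 / (t + 1) := by positivity
  have e2 : (1 : ℝ) / (t + 1 + 1) ≤ 1 / 2 := one_div_le_one_div_of_le (by norm_num) (by linarith)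
  -- Since `2K - 2 ≤ t ≤ 2K`, `2 ^ t` is within a factor `4` of `2 ^ (2K)` and `t²` is comparable
  -- with `K²`.
  have htK : (t : ℝ) ≤ 2 * K := by linarith
  have hKt : 2 * K - 2 ≤ t := by linarith
  have p1 : (2 : ℝ) ^ t ≤ 2 ^ (2 * K) := by
    rw [← Real.rpow_natCast]
    exact Real.rpow_le_rpow_of_exponent_le (by norm_num) htK
  have p2 : (2 : ℝ) ^ (2 * K) ≤ 4 * 2 ^ t := by
    have : (2 : ℝ) ^ (2 * K - 2) ≤ 2 ^ (t : ℝ) :=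
      Real.rpow_le_rpow_of_exponent_le (by norm_num) hKt
    rw [Real.rpow_natCast, Real.rpow_sub (by norm_num)] at this
    norm_num at this
    linarith
  have hq : (0 : ℝ) < 2 ^ t := by positivity
  have hX : (0 : ℝ) < 2 ^ (2 * K) := by positivity
  constructor
  · have hb : K / slopeDensity t K ≤ K / midDensity t :=
      div_le_div_of_nonneg_left hK0.le (midDensity_pos t) (midDensity_le_slopeDensity t K)
    refine hb.trans ?_
    rw [midDensity, mul_div_assoc', div_div_eq_mul_div,
      div_le_div_iff₀ (by positivity) hK0, pow_succ (2 : ℝ) t]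
    have h3 : K * K ≤ (t : ℝ) ^ 2 + t + 1 := by nlinarith
    have h4 : 2 ^ t * (K * K) ≤ (2 : ℝ) ^ (2 * K) * ((t : ℝ) ^ 2 + t + 1) :=
      mul_le_mul p1 h3 (by positivity) hX.le
    linarith
  · have hb : K / ballDensity t ≤ K / slopeDensity t K :=
      div_le_div_of_nonneg_left hK0.le (slopeDensity_pos t K) (slopeDensity_le_ballDensity t K)
    refine le_trans ?_ (mul_le_mul_of_nonneg_left hb (by norm_num))
    rw [ballDensity, div_div_eq_mul_div, mul_div_assoc',
      div_le_div_iff₀ hK0 (by positivity), pow_succ (2 : ℝ) t]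
    have h3 : (t : ℝ) ^ 2 + t + 2 ≤ 6 * (K * K) := by nlinarith
    have h4 : (2 : ℝ) ^ (2 * K) * ((t : ℝ) ^ 2 + t + 2) ≤ (4 * 2 ^ t) * (6 * (K * K)) :=
      mul_le_mul p2 h3 (by positivity) (by positivity)
    linarith

theorem isTheta_freimanF :
    Asymptotics.IsTheta Filter.atTop freimanF (fun K : ℝ => (2 : ℝ) ^ (2 * K) / K) := by
  have hg : ∀ K : ℝ, 2 ≤ K → 0 ≤ (2 : ℝ) ^ (2 * K) / K := fun K hK => by
    have : 0 < K := by linarith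
    positivity
  refine ⟨Asymptotics.IsBigO.of_bound 2 ?_, Asymptotics.IsBigO.of_bound 12 ?_⟩ <;>
    filter_upwards [Filter.eventually_ge_atTop 2] with K hK <;>
    obtain ⟨h1, h2⟩ := freimanF_bounds hK <;>
    have h0 := hg K hK <;>
    have hF : 0 ≤ freimanF K := by linarith
  · rwa [Real.norm_of_nonneg hF, Real.norm_of_nonneg h0]
  · rwa [Real.norm_of_nonneg hF, Real.norm_of_nonneg h0]

end Value

theorem theorem2 :
    (∀ K : ℝ, 1 ≤ K →
      -- the range of `K` determines a unique positive integer `t`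
      (∃! t : ℕ, 1 ≤ t ∧ breakpoint t ≤ K ∧ K < breakpoint (t + 1)) ∧
      -- `F(K)` is a valid upper bound for all sets of doubling at most `K`, and the best one
      IsLUB (spanningConstants K) (freimanF K) ∧
      -- the exact value of `F(K)`
      (∀ t : ℕ, 1 ≤ t → breakpoint t ≤ K → K < breakpoint (t + 1) →
        (K < midBreakpoint t →
          freimanF K = (2 : ℝ) ^ t / ((t.choose 2 : ℝ) + t + 1) * K) ∧
        (midBreakpoint t ≤ K →
          freimanF K = (2 : ℝ) ^ (t + 1) / ((t : ℝ) ^ 2 + t + 1) * K))) ∧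
    -- the growth of `F(K)` as `K → ∞`
    Asymptotics.IsTheta Filter.atTop freimanF (fun K : ℝ => (2 : ℝ) ^ (2 * K) / K) := by
  refine ⟨fun K hK => ⟨existsUnique_breakpoint_le hK, ?_, fun t ht h1 h2 => ⟨fun hm => ?_,
    fun hm => ?_⟩⟩, isTheta_freimanF⟩
  · obtain ⟨t, ⟨ht, h1, h2⟩, -⟩ := existsUnique_breakpoint_le hK
    rw [freimanF_eq ht h1 h2]
    exact isLUB_spanningConstants ht h1 h2
  · rw [freimanF_eq ht h1 h2, slopeDensity, if_pos hm, ballDensity, Nat.cast_choose_two]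
    have h3 : (t : ℝ) ^ 2 + t + 2 ≠ 0 := by positivity
    have h4 : (t : ℝ) * (t - 1) / 2 + t + 1 = ((t : ℝ) ^ 2 + t + 2) / 2 := by ring
    rw [h4]
    field_simp
    ring
  · rw [freimanF_eq ht h1 h2, slopeDensity, if_neg (not_lt.2 hm), midDensity]
    field_simp
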